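/- **Setting.** Let $n\ge 4$ be a multiple of $4$ and $n_0=n/4$. Let $\mathcal C$ be the unit circle of $\mathbb C=\mathbb R^2$ with geodesic distance $d$, let $\mathcal O$ be the group of rotations and reflections of the plane, and put $d_\infty(\mathbf x,\mathbf y)=\max_i d(x_i,y_i)$. For $k\ge 1$ let $\mathcal C_k=\{e^{2\pi\iota j/k}:0\le j<k\}$. For an index set $T$ with $k$ elements let $\boldsymbol\Pi_T$ be the set of tuples $(x_i)_{i\in T}$ that enumerate $\mathcal C_k$ bijectively; write $\boldsymbol\Pi_n=\boldsymbol\Pi_{[n]}$ and $d_\infty(\mathbf x,\boldsymbol\Pi_n)=\min_{\mathbf y\in\boldsymbol\Pi_n}d_\infty(\mathbf x,\mathbf y)$. For $c_e\ge 0$, $0<c_l\le c_L$ and $\varepsilon_n=c_e\sqrt{\log(n)/n}$, let $\mathcal{BL}[c_l,c_L,c_e]$ be the set of symmetric functions $f:\mathcal C^2\to[0,1]$ such that, for all $x,y,y'\in\mathcal C$, $|f(x,y)-f(x,y')|\le c_L d(y,y')+\varepsilon_n$ and, if $d(x,y)\ge d(x,y')$, $f(x,y')-f(x,y)\ge c_l(d(x,y)-d(x,y'))-\varepsilon_n$.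 The data are a symmetric $n\times n$ matrix $A$ with zero diagonal and $A_{ij}=F_{ij}+E_{ij}$, $F_{ij}=f^*(x_i^*,x_j^*)$ for $i<j$, where $\mathbf x^*\in\mathcal C^n$ and $f^*\in\mathcal{BL}[c_l,c_L,c_e]$ are fixed and the $E_{ij}$, $i<j$, are independent, centered and sub-Gaussian(1), i.e. $\mathbb P\big[\sum_{i<j}B_{ij}E_{ij}>t\sqrt{\sum_{i<j}B_{ij}^2}\,\big]\le e^{-t^2/2}$ for all real $B$ and $t\ge 0$. Let $$\mathcal R[F]=\{(\mathbf x,f)\in\mathcal C^n\times\mathcal{BL}[c_l,c_L,c_e]: f(x_i,x_j)=F_{ij}\ \text{for all } i<j\},\qquad b[F]=\inf_{(\mathbf x',f')\in\mathcal R[F]}d_\infty(\mathbf x',\boldsymbol\Pi_n),$$ and let $\mathcal R_{\boldsymbol\Pi_n}[F]=\{(\mathbf x,f)\in\mathcal R[F]: d_\infty(\mathbf x,\boldsymbol\Pi_n)=b[F]\}$. **Localize-and-Refine estimator.** Independently of $E$, draw $S$ uniformly among the subsets of $[n]$ of size $n_0$ and then $S'$ uniformly among the subsets of $\overline S=[n]\setminus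 S$ of size $n_0$. Choose $$\hat{\mathbf x}^{(1)}_S\in\operatorname*{argmin}_{\mathbf x\in\boldsymbol\Pi_S}\sum_{i,j\in S}A_{ij}\,d(x_i,x_j),\qquad \hat x^{(2)}_i\in\operatorname*{argmin}_{z\in\mathcal C_{n_0}}\sum_{j\in S}A_{ij}\,d(z,\hat x^{(1)}_j)\quad(i\in\overline S),$$ and in the same way $\hat{\mathbf x}^{(1')}_{S'}$ and $\hat x^{(2')}_i$ ($i\in\overline{S'}$) from $S'$. Ties in the choice of $\hat{\mathbf x}^{(1)}_S$ (resp. $\hat{\mathbf x}^{(1')}_{S'}$) are broken by a measurable rule that uses $S$ and $A_{SS}$ only (resp. $S'$ and $A_{S'S'}$ only); all other minimizers are arbitrary. Choose $\widehat Q\in\operatorname{argmin}_{Q\in\mathcal O}\max_{i\in\overline S\cap\overline{S'}}d(\hat x^{(2)}_i,Q\hat x^{(2')}_i)$, and set $\hat x_j=\hat x^{(2)}_j$ for $j\in\overline S$ and $\hat x_j=\widehat Q\hat x^{(2')}_j$ for $j\in S$. The estimator has no tuning parameter; it does not depend on $c_l,c_L,c_e$. **Theorem.** For all $c_e\ge0$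 and $0<c_l\le c_L$ there is a constant $C>0$, depending only on $c_e,c_l,c_L$, such that in the above setting there is an event of probability at least $1-5/n^2$ on which the following holds: 1. for every $\eta>0$ there is a representation $(\mathbf x,f)\in\mathcal R[F]$ with $d_\infty(\mathbf x,\boldsymbol\Pi_n)\le b[F]+\eta$ and $$d_\infty(\hat{\mathbf x},\mathbf x)\le C\Big(b[F]+\sqrt{\log(n)/n}\Big);$$ 2. if the infimum $b[F]$ is attained, i.e. if $\mathcal R_{\boldsymbol\Pi_n}[F]\ne\emptyset$, then there is even a representation $(\mathbf x,f)\in\mathcal R_{\boldsymbol\Pi_n}[F]$ with this bound. In particular this is so whenever $c_e=0$, since then $\mathcal R_{\boldsymbol\Pi_n}[F]$ is never empty. -/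

import Mathlib

open MeasureTheory ProbabilityTheory

noncomputable section

namespace LatentCircle

/-! ### The circle, its geodesic distance, regular positions -/

/-- Geodesic distance on the unit circle: the length in `[0, π]` of the shorter arc joining `x` and
`y`, i.e. the unoriented angle between the two unit vectors. -/
def geoDist (x y : Circle) : ℝ := InnerProductGeometry.angle (x : ℂ) (y : ℂ)

/-- The action of an orthogonal transformation of the plane `ℂ = ℝ²` (a rotation or a reflection)
on the unit circle. -/
def act (Q : ℂ ≃ₗᵢ[ℝ] ℂ) (x : Circle) : Circle :=
  ⟨Q (x : ℂ), mem_sphere_zero_iff_norm.2 ((Q.norm_map _).trans x.norm_coe)⟩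

/-- Maximum distance between two tuples of points of the circle. -/
def dInf {ι : Type*} (x y : ι → Circle) : ℝ := ⨆ i, geoDist (x i) (y i)

/-- The `j`-th point of the regular grid with `k` points. -/
def gridPoint (k j : ℕ) : Circle := Circle.exp (2 * Real.pi * j / k)

/-- The regular grid with `k` points. -/
def grid (k : ℕ) : Set Circle := {z | ∃ j < k, z = gridPoint k j}

/-- Regular positions: tuples indexed by a finite set of cardinality `k` which enumerate
bijectively the regular grid with `k` points. -/
def regularPositions (ι : Type*) [Fintype ι] : Set (ι → Circle) :=
  {x | ∃ σ : ι ≃ Fin (Fintype.card ι), ∀ i, x i = gridPoint (Fintype.card ι) (σ i)}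

/-- Distance of a tuple to the (finite) set of regular positions. -/
def dReg {ι : Type*} [Fintype ι] (x : ι → Circle) : ℝ :=
  sInf (dInf x '' regularPositions ι)

/-! ### Bi-Lipschitz affinities and representations -/

/-- The slack `ε_n`. -/
def slack (n : ℕ) (ce : ℝ) : ℝ := ce * √(Real.log n / n)

/-- Bi-Lipschitz affinity functions. -/
structure IsBiLipschitz (n : ℕ) (cl cL ce : ℝ) (f : Circle → Circle → ℝ) : Prop where
  mem_unit : ∀ x y, f x y ∈ Set.Icc (0 : ℝ) 1
  symm : ∀ x y, f x y = f y x
  upper : ∀ x y y', |f x y - f x y'| ≤ cL * geoDist y y' + slack n ce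
  lower : ∀ x y y', geoDist x y' ≤ geoDist x y →
    cl * (geoDist x y - geoDist x y') - slack n ce ≤ f x y' - f x y

/-- Representations `(x, f)` of the off-diagonal part of a mean matrix `F`. -/
def reps {n : ℕ} (cl cL ce : ℝ) (F : Fin n → Fin n → ℝ) :
    Set ((Fin n → Circle) × (Circle → Circle → ℝ)) :=
  {p | IsBiLipschitz n cl cL ce p.2 ∧ ∀ i j, i < j → p.2 (p.1 i) (p.1 j) = F i j}

/-- Representations whose positions are the closest to regular positions (the set of minimizers of
`(x, f) ↦ dReg x` over all representations). -/
def closestReps {n : ℕ} (cl cL ce : ℝ) (F : Fin n → Fin n → ℝ) :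
    Set ((Fin n → Circle) × (Circle → Circle → ℝ)) :=
  {p | p ∈ reps cl cL ce F ∧ ∀ q ∈ reps cl cL ce F, dReg p.1 ≤ dReg q.1}

/-- Infimum over all representations of the distance to regular positions. -/
def bias {n : ℕ} (cl cL ce : ℝ) (F : Fin n → Fin n → ℝ) : ℝ :=
  sInf ((fun p => dReg p.1) '' reps cl cL ce F)

/-! ### The data -/

section Data

variable {Ω : Type*} [MeasurableSpace Ω]

/-- The upper-diagonal positions of an `n × n` matrix. -/
abbrev UpperPair (n : ℕ) : Type := {p : Fin n × Fin n // p.1 < p.2}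

/-- Independent, centered noise entries above the diagonal, with the sub-Gaussian(1) tail bound for
all linear combinations. -/
structure IsSubGaussianNoise {n : ℕ} (P : Measure Ω) (E : UpperPair n → Ω → ℝ) : Prop where
  meas : ∀ p, Measurable (E p)
  indep : iIndepFun E P
  centered : ∀ p, Integrable (E p) P ∧ ∫ ω, E p ω ∂P = 0
  tail : ∀ (B : UpperPair n → ℝ) (t : ℝ), 0 ≤ t →
    P.real {ω | t * √(∑ p, B p ^ 2) < ∑ p, B p * E p ω} ≤ Real.exp (-t ^ 2 / 2)

/-- The symmetric observation matrix built from a mean matrix `F` and the noise `e` above the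
diagonal, with zero diagonal; only the entries of `F` above the diagonal are used. -/
def observation {n : ℕ} (F : Fin n → Fin n → ℝ) (e : UpperPair n → ℝ) (i j : Fin n) : ℝ :=
  if h : i < j then F i j + e ⟨(i, j), h⟩
  else if h : j < i then F j i + e ⟨(j, i), h⟩
  else 0

/-- `S` is uniform among the subsets of `[n]` of size `n/4` and, given `S`, the set `S'` is uniform
among the subsets of the complement of `S` of size `n/4`. -/
structure IsRandomSplit {n : ℕ} (P : Measure Ω) (S S' : Ω → Finset (Fin n)) : Prop where
  meas : Measurable S
  meas' : Measurable S'
  first : ∀ s : Finset (Fin n), s.card = n / 4 →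
    P.real {ω | S ω = s} = 1 / (n.choose (n / 4) : ℝ)
  second : ∀ s s' : Finset (Fin n), s.card = n / 4 → s'.card = n / 4 → s' ⊆ sᶜ →
    P.real {ω | S ω = s ∧ S' ω = s'} =
      P.real {ω | S ω = s} * (1 / ((n - n / 4).choose (n / 4) : ℝ))

end Data

/-! ### The Localize-and-Refine estimator -/

/-- The criterion `⟨B, D(x)⟩` of the initial localization. -/
def initCriterion {ι : Type*} [Fintype ι] (B : ι → ι → ℝ) (x : ι → Circle) : ℝ :=
  ∑ i, ∑ j, B i j * geoDist (x i) (x j)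

/-- A version of the initial estimator: for every index set `S`, a measurable function of the
submatrix `A_{SS}` alone, with values in the set of minimizers of the criterion over regular
positions.  (Minimizers are never unique; a version is a rule for breaking the ties.  It takes
finitely many values, so that measurability is that of its level sets.) -/
structure InitialEstimator (n : ℕ) where
  toFun : ∀ S : Finset (Fin n), (S → S → ℝ) → (S → Circle)
  measurable_level : ∀ (S : Finset (Fin n)) (x : S → Circle), MeasurableSet {B | toFun S B = x}
  regular : ∀ (S : Finset (Fin n)) (B : S → S → ℝ), toFun S B ∈ regularPositions S
  minimal : ∀ (S : Finset (Fin n)) (B : S → S → ℝ), ∀ y ∈ regularPositions S,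
    initCriterion B (toFun S B) ≤ initCriterion B y

/-- The submatrix `A_{SS}`. -/
def submatrix {n : ℕ} (A : Fin n → Fin n → ℝ) (S : Finset (Fin n)) : S → S → ℝ :=
  fun i j => A i j

/-- `x2` is a refined estimator on the complement of `S`, with input the initial estimator `x1` on
`S`.  The values of `x2` on `S` are irrelevant. -/
def IsRefined {n : ℕ} (A : Fin n → Fin n → ℝ) (S : Finset (Fin n)) (x1 : S → Circle)
    (x2 : Fin n → Circle) : Prop :=
  ∀ i, i ∉ S → x2 i ∈ grid (n / 4) ∧ ∀ z ∈ grid (n / 4),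
    ∑ j : S, A i j * geoDist (x2 i) (x1 j) ≤ ∑ j : S, A i j * geoDist z (x1 j)

/-- Maximum distance between two tuples restricted to the index set `T`. -/
def dInfOn {n : ℕ} (T : Finset (Fin n)) (x y : Fin n → Circle) : ℝ :=
  dInf (fun i : T => x i) (fun i : T => y i)

/-- `Q` synchronizes `x2'` with `x2` on `T`. -/
def IsSynchronizer {n : ℕ} (T : Finset (Fin n)) (x2 x2' : Fin n → Circle)
    (Q : ℂ ≃ₗᵢ[ℝ] ℂ) : Prop :=
  ∀ Q' : ℂ ≃ₗᵢ[ℝ] ℂ,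
    dInfOn T x2 (fun i => act Q (x2' i)) ≤ dInfOn T x2 (fun i => act Q' (x2' i))

/-- `xhat` is an output of the Localize-and-Refine procedure on the matrix `A` with the splits
`S`, `S'`, using the versions `I` and `I'` of the initial estimator in its first and second run.
All other minimizers are arbitrary. -/
def IsLocalizeAndRefine {n : ℕ} (I I' : InitialEstimator n) (A : Fin n → Fin n → ℝ)
    (S S' : Finset (Fin n)) (xhat : Fin n → Circle) : Prop :=
  ∃ (x2 x2' : Fin n → Circle) (Q : ℂ ≃ₗᵢ[ℝ] ℂ),
    IsRefined A S (I.toFun S (submatrix A S)) x2 ∧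
    IsRefined A S' (I'.toFun S' (submatrix A S')) x2' ∧
    IsSynchronizer (Sᶜ ∩ S'ᶜ) x2 x2' Q ∧
    ∀ j, xhat j = if j ∈ S then act Q (x2' j) else x2 j

end LatentCircle

end

open LatentCircle

/-! Any representation of `F` can replace the true one in the analysis. Fix regular positions `y`,
and a representation `p` whose positions lie within `δ = b[F] + √(log n / n)` of `y`. All error
bounds are proportional to `δ`, up to an isometry of the circle.

Curvature of the criteria. Rotations by roots of unity permute the grid, so the distances seen from
one grid point are a permutation of those seen from another. An affinity decreasing in the distance
with slope `cl` then satisfies a quantitative rearrangement inequality (`rearrangement_gap`): the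
criterion exceeds its value at the correct configuration by a quadratic amount. Model error and
noise enter only linearly in the deviation, so minimality bounds the deviation. For the initial
localization (`localization_bound`) this controls the pairwise distances in Frobenius norm. For the
refinement (`refinement_bound`) it controls each single position, and there only the average initial
error matters.

From distances to positions. Cosines of the distances form Gram matrices. For regular positions the
Gram discrepancy is `k² - |α|² - |β|²`, where `α` and `β` are the correlations with `y` and with its
conjugate, and `|α| + |β| ≤ k`. The larger correlation gives an aligning rotation or reflection
(`exists_alignment`).

Randomness. A uniform `S` takes a nearly fair share of each initial segment of the grid, so `y`
restricted to `S` is nearly regular (`measureReal_not_spread_le`). The noise is handled by union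
bounds over finitely many configurations. The initial estimator uses only the noise inside `S` and
the refinement only noise on pairs leaving `S`; this independence makes the initial estimate
effectively deterministic in the second bound (`measureReal_badRun_le`).

Gluing. Both runs are accurate on half of the indices. The synchronizer therefore agrees with the
correct relative isometry there, and a spurious reflection is excluded because it cannot almost fix
half of the grid (`synchronization_bound`). The remaining global isometry is rounded to a symmetry
of the grid, which moves `p` to another representation no farther from regular positions.

The event may not depend on `η`. Since there are finitely many regular positions, one `y` serves all
`η` and also the attained infimum (`exists_common_regularPositions`). For `ce = 0` attainment
follows from Tychonoff compactness (`closestReps_nonempty`). -/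

namespace LatentCircle

open scoped ComplexConjugate

/-! ### Geodesic distance and isometries of the circle -/

lemma geoDist_nonneg (x y : Circle) : 0 ≤ geoDist x y := InnerProductGeometry.angle_nonneg _ _

lemma geoDist_le_pi (x y : Circle) : geoDist x y ≤ Real.pi := InnerProductGeometry.angle_le_pi _ _

lemma geoDist_comm (x y : Circle) : geoDist x y = geoDist y x :=
  InnerProductGeometry.angle_comm _ _

@[simp] lemma geoDist_self (x : Circle) : geoDist x x = 0 :=
  InnerProductGeometry.angle_self (Circle.coe_ne_zero x)

lemma geoDist_triangle (x y z : Circle) : geoDist x z ≤ geoDist x y + geoDist y z :=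
  InnerProductGeometry.angle_le_angle_add_angle _ _ _

lemma abs_geoDist_sub_le (x y w : Circle) : |geoDist x w - geoDist y w| ≤ geoDist x y := by
  have h1 := geoDist_triangle x y w
  have h2 := geoDist_triangle y x w
  rw [geoDist_comm y x] at h2
  exact abs_le.2 ⟨by linarith, by linarith⟩

lemma cos_geoDist (x y : Circle) : Real.cos (geoDist x y) = ((x : ℂ) * conj (y : ℂ)).re := by
  unfold geoDist
  rw [InnerProductGeometry.cos_angle]
  simp [Complex.inner, mul_comm, Circle.norm_coe]

lemma norm_sub_le_geoDist (x y : Circle) : ‖(x : ℂ) - y‖ ≤ geoDist x y :=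
  Complex.norm_sub_le_angle x.norm_coe y.norm_coe

lemma geoDist_le_norm_sub (x y : Circle) : geoDist x y ≤ Real.pi / 2 * ‖(x : ℂ) - y‖ :=
  Complex.angle_le_mul_norm_sub x.norm_coe y.norm_coe

lemma norm_sub_sq_circle (x y : Circle) :
    ‖(x : ℂ) - y‖ ^ 2 = 2 - 2 * ((x : ℂ) * conj (y : ℂ)).re := by
  rw [← Complex.normSq_eq_norm_sq, Complex.normSq_sub]
  simp; ring

lemma geoDist_mul_left (a x y : Circle) : geoDist (a * x) (a * y) = geoDist x y := by
  simp [geoDist]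

lemma continuous_geoDist {X : Type*} [TopologicalSpace X] {u v : X → Circle} (hu : Continuous u)
    (hv : Continuous v) : Continuous fun a => geoDist (u a) (v a) := by
  rw [continuous_iff_continuousAt]
  intro a
  have h := InnerProductGeometry.continuousAt_angle (x := ((u a : ℂ), (v a : ℂ)))
    (Circle.coe_ne_zero (u a)) (Circle.coe_ne_zero (v a))
  exact ContinuousAt.comp (f := fun a => ((u a : ℂ), (v a : ℂ))) h (by fun_prop)

lemma geoDist_exp_le (s t : ℝ) : geoDist (Circle.exp s) (Circle.exp t) ≤ |s - t| := by
  rcases lt_or_ge |s - t| Real.pi with h | h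
  · unfold geoDist
    rw [Circle.coe_exp, Circle.coe_exp, Complex.angle_exp_exp, (toIocMod_eq_self _).2]
    have := abs_lt.1 h
    exact ⟨this.1, by linarith⟩
  · exact (geoDist_le_pi _ _).trans h

@[simp] lemma coe_act (Q : ℂ ≃ₗᵢ[ℝ] ℂ) (x : Circle) : (act Q x : ℂ) = Q x := rfl

@[simp] lemma geoDist_act (Q : ℂ ≃ₗᵢ[ℝ] ℂ) (x y : Circle) :
    geoDist (act Q x) (act Q y) = geoDist x y :=
  Q.toLinearIsometry.angle_map _ _

@[simp] lemma act_trans (Q R : ℂ ≃ₗᵢ[ℝ] ℂ) (x : Circle) : act (Q.trans R) x = act R (act Q x) :=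
  rfl

@[simp] lemma act_symm_act (Q : ℂ ≃ₗᵢ[ℝ] ℂ) (x : Circle) : act Q.symm (act Q x) = x :=
  Circle.ext (by simp)

@[simp] lemma act_act_symm (Q : ℂ ≃ₗᵢ[ℝ] ℂ) (x : Circle) : act Q (act Q.symm x) = x :=
  Circle.ext (by simp)

@[simp] lemma act_rotation (a x : Circle) : act (rotation a) x = a * x :=
  Circle.ext (by simp)

@[simp] lemma act_conj_rotation (a x : Circle) :
    act (Complex.conjLIE.trans (rotation a)) x = a * x⁻¹ :=
  Circle.ext (by rw [Circle.coe_mul, Circle.coe_inv_eq_conj]; simp)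

lemma act_eq_rotation_or_reflection (Q : ℂ ≃ₗᵢ[ℝ] ℂ) :
    ∃ a : Circle, (∀ x, act Q x = a * x) ∨ ∀ x, act Q x = a * x⁻¹ := by
  obtain ⟨a, rfl | rfl⟩ := linear_isometry_complex Q
  · exact ⟨a, .inl fun x => by simp⟩
  · exact ⟨a, .inr fun x => act_conj_rotation a x⟩

/-! ### Maximum distance of tuples -/

lemma geoDist_le_dInf {ι : Type*} [Finite ι] (x y : ι → Circle) (i : ι) :
    geoDist (x i) (y i) ≤ dInf x y :=
  le_ciSup (f := fun i => geoDist (x i) (y i)) (Set.finite_range _).bddAbove i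

lemma dInf_le {ι : Type*} {x y : ι → Circle} {c : ℝ} (hc : 0 ≤ c)
    (h : ∀ i, geoDist (x i) (y i) ≤ c) : dInf x y ≤ c :=
  Real.iSup_le h hc

lemma dInf_nonneg {ι : Type*} (x y : ι → Circle) : 0 ≤ dInf x y :=
  Real.iSup_nonneg fun _ => geoDist_nonneg _ _

lemma dInf_act {ι : Type*} (Q : ℂ ≃ₗᵢ[ℝ] ℂ) (x y : ι → Circle) :
    dInf (fun i => act Q (x i)) (fun i => act Q (y i)) = dInf x y := by
  simp [dInf]

lemma finite_regularPositions (ι : Type*) [Fintype ι] : (regularPositions ι).Finite := by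
  classical
  refine (Set.finite_range fun (σ : ι ≃ Fin (Fintype.card ι)) (i : ι) =>
    gridPoint (Fintype.card ι) (σ i)).subset ?_
  rintro x ⟨σ, hσ⟩
  exact ⟨σ, funext fun i => (hσ i).symm⟩

lemma regularPositions_nonempty (ι : Type*) [Fintype ι] : (regularPositions ι).Nonempty :=
  ⟨fun i => gridPoint (Fintype.card ι) (Fintype.equivFin ι i), Fintype.equivFin ι, fun _ => rfl⟩

lemma exists_dInf_eq_dReg {ι : Type*} [Fintype ι] (x : ι → Circle) :
    ∃ y ∈ regularPositions ι, dInf x y = dReg x :=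
  ((regularPositions_nonempty ι).image (dInf x)).csInf_mem ((finite_regularPositions ι).image _)

lemma dReg_le_dInf {ι : Type*} [Fintype ι] (x : ι → Circle) {y : ι → Circle}
    (hy : y ∈ regularPositions ι) : dReg x ≤ dInf x y :=
  csInf_le ((finite_regularPositions ι).image _).bddBelow ⟨y, hy, rfl⟩

lemma dReg_nonneg {ι : Type*} [Fintype ι] (x : ι → Circle) : 0 ≤ dReg x := by
  obtain ⟨y, -, h⟩ := exists_dInf_eq_dReg x
  exact h ▸ dInf_nonneg x y

/-! ### Regular positions as bijections onto the roots of unity -/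

lemma gridPoint_eq_pow (k j : ℕ) : gridPoint k j = gridPoint k 1 ^ j := by
  unfold gridPoint
  rw [← Circle.exp_natCast_mul]; congr 1; push_cast; ring

lemma gridPoint_pow_self {k : ℕ} (hk : k ≠ 0) (j : ℕ) : gridPoint k j ^ k = 1 := by
  unfold gridPoint
  rw [← Circle.exp_natCast_mul, Circle.exp_eq_one]
  exact ⟨j, by push_cast; field_simp⟩

lemma gridPoint_injective {k a b : ℕ} (ha : a < k) (hb : b < k)
    (h : gridPoint k a = gridPoint k b) : a = b := by
  unfold gridPoint at h
  obtain ⟨m, hm⟩ := Circle.exp_eq_exp.1 h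
  have hk : (k : ℝ) ≠ 0 := by positivity [(by omega : 0 < k)]
  have h1 : (a : ℝ) = b + m * k := by
    field_simp at hm
    nlinarith [hm, Real.pi_pos]
  have h2 : (a : ℤ) = b + m * k := by exact_mod_cast h1
  have h3 : (a : ℤ) % k = (b : ℤ) % k := by rw [h2]; simp
  rw [Int.emod_eq_of_lt (by omega) (by omega), Int.emod_eq_of_lt (by omega) (by omega)] at h3
  exact_mod_cast h3

lemma exists_eq_gridPoint {k : ℕ} (hk : k ≠ 0) {z : Circle} (hz : z ^ k = 1) :
    ∃ j < k, z = gridPoint k j := by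
  obtain ⟨θ, rfl⟩ := Circle.exp_surjective z
  rw [← Circle.exp_natCast_mul, Circle.exp_eq_one] at hz
  obtain ⟨m, hm⟩ := hz
  have hk' : (0 : ℤ) < k := by omega
  have hm0 := Int.emod_nonneg m hk'.ne'
  have hm1 := Int.emod_lt_of_pos m hk'
  refine ⟨(m % k).toNat, by omega, ?_⟩
  unfold gridPoint
  rw [Circle.exp_eq_exp]
  refine ⟨m / k, ?_⟩
  have h1 : (((m % k).toNat : ℕ) : ℝ) = m - k * ((m / k : ℤ) : ℝ) := by
    have : (((m % k).toNat : ℕ) : ℤ) = m - k * (m / k) := by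
      rw [Int.toNat_of_nonneg hm0]; have := Int.emod_add_mul_ediv m k; linarith
    exact_mod_cast this
  rw [h1]
  have hk'' : (k : ℝ) ≠ 0 := by exact_mod_cast hk
  field_simp
  linear_combination hm

lemma mem_grid_iff {k : ℕ} (hk : k ≠ 0) {z : Circle} : z ∈ grid k ↔ z ^ k = 1 :=
  ⟨fun ⟨j, _, h⟩ => h ▸ gridPoint_pow_self hk j, exists_eq_gridPoint hk⟩

/-- Equal cardinalities turn injectivity into bijectivity onto the grid. This form makes stability
under the group operations immediate. -/
lemma mem_regularPositions_iff {ι : Type*} [Fintype ι] (hι : Fintype.card ι ≠ 0)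
    {x : ι → Circle} :
    x ∈ regularPositions ι ↔ Function.Injective x ∧ ∀ i, x i ^ Fintype.card ι = 1 := by
  constructor
  · rintro ⟨σ, hσ⟩
    refine ⟨fun i j h => ?_, fun i => by rw [hσ]; exact gridPoint_pow_self hι _⟩
    rw [hσ, hσ] at h
    exact σ.injective (Fin.ext (gridPoint_injective (σ i).2 (σ j).2 h))
  · rintro ⟨hinj, hx⟩
    choose s hs hxs using fun i => exists_eq_gridPoint hι (hx i)
    have hb : Function.Bijective (fun i => (⟨s i, hs i⟩ : Fin (Fintype.card ι))) := by
      rw [Fintype.bijective_iff_injective_and_card]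
      refine ⟨fun i j h => hinj ?_, by simp⟩
      rw [hxs i, hxs j, show s i = s j from congrArg Fin.val h]
    exact ⟨Equiv.ofBijective _ hb, fun i => hxs i⟩

lemma exists_of_mem_regularPositions {ι : Type*} [Fintype ι] {x : ι → Circle}
    (hx : x ∈ regularPositions ι) {z : Circle} (hι : Fintype.card ι ≠ 0)
    (hz : z ^ Fintype.card ι = 1) : ∃ i, x i = z := by
  obtain ⟨σ, hσ⟩ := hx
  obtain ⟨j, hj, rfl⟩ := exists_eq_gridPoint hι hz
  exact ⟨σ.symm ⟨j, hj⟩, by simp [hσ]⟩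

/-- Multiplication by a root of unity permutes regular positions. -/
lemma exists_perm_mul {ι : Type*} [Fintype ι] {x y : ι → Circle} (hι : Fintype.card ι ≠ 0)
    (hx : x ∈ regularPositions ι) (hy : y ∈ regularPositions ι) {c : Circle}
    (hc : c ^ Fintype.card ι = 1) : ∃ π : Equiv.Perm ι, ∀ i, x (π i) = c * y i := by
  obtain ⟨hyi, hyp⟩ := (mem_regularPositions_iff hι).1 hy
  choose p hp using fun i => exists_of_mem_regularPositions hx (z := c * y i) hι
    (by rw [mul_pow, hc, hyp, one_mul])
  have hb : Function.Bijective p := by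
    rw [← Finite.injective_iff_bijective]
    intro i j h
    apply hyi
    have := (hp i).symm.trans ((congrArg x h).trans (hp j))
    exact mul_left_cancel this
  exact ⟨Equiv.ofBijective p hb, hp⟩

/-- Regular positions annihilate the non-trivial characters of the grid. -/
lemma sum_pow_regularPositions {ι : Type*} [Fintype ι] {x : ι → Circle}
    (hx : x ∈ regularPositions ι) {m : ℕ} (hm : 0 < m) (hmk : m < Fintype.card ι) :
    ∑ i, (x i : ℂ) ^ m = 0 := by
  have hι : Fintype.card ι ≠ 0 := by omega
  set ζ := gridPoint (Fintype.card ι) 1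
  obtain ⟨π, hπ⟩ := exists_perm_mul hι hx hx (gridPoint_pow_self hι 1)
  have h1 : ∑ i, (x i : ℂ) ^ m = (ζ : ℂ) ^ m * ∑ i, (x i : ℂ) ^ m := by
    conv_lhs => rw [← Equiv.sum_comp π]
    rw [Finset.mul_sum]
    refine Finset.sum_congr rfl fun i _ => ?_
    rw [hπ, Circle.coe_mul, mul_pow]
  have h2 : (ζ : ℂ) ^ m ≠ 1 := by
    intro h
    have h3 : ζ ^ m = 1 := Circle.ext (by simpa using h)
    rw [← gridPoint_eq_pow] at h3
    have h4 : gridPoint (Fintype.card ι) 0 = 1 := by simp [gridPoint]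
    have := gridPoint_injective hmk (by omega) (h3.trans h4.symm)
    omega
  have h3 : (1 - (ζ : ℂ) ^ m) * ∑ i, (x i : ℂ) ^ m = 0 := by linear_combination h1
  exact (mul_eq_zero.1 h3).resolve_left (sub_ne_zero.2 (Ne.symm h2))

/-- Every point of the circle is within `π / k` of the regular grid. -/
lemma exists_grid_near {k : ℕ} (hk : k ≠ 0) (z : Circle) :
    ∃ w : Circle, w ^ k = 1 ∧ geoDist w z ≤ Real.pi / k := by
  obtain ⟨θ, rfl⟩ := Circle.exp_surjective z
  have hk' : (0 : ℝ) < k := by positivity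
  set m := round (k * θ / (2 * Real.pi))
  refine ⟨Circle.exp (2 * Real.pi * m / k), ?_, (geoDist_exp_le _ _).trans ?_⟩
  · rw [← Circle.exp_natCast_mul, Circle.exp_eq_one]
    exact ⟨m, by field_simp⟩
  · have h := abs_sub_round (k * θ / (2 * Real.pi))
    have : 2 * Real.pi * m / k - θ = -(2 * Real.pi / k) * (k * θ / (2 * Real.pi) - m) := by
      field_simp; ring
    rw [this, abs_mul, abs_neg, abs_of_pos (by positivity)]
    calc _ ≤ 2 * Real.pi / k * (1 / 2) := by gcongr
      _ = _ := by ring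

/-! ### A quantitative rearrangement inequality -/

/-- If `φ` decreases with slope at least `c` along `a`, up to an additive slack `ε`, then permuting
`a` increases its correlation with `φ`. -/
lemma rearrangement_gap {ι : Type*} [Fintype ι] (a φ : ι → ℝ) (π : Equiv.Perm ι) {c ε : ℝ}
    (h : ∀ i j, a j ≤ a i → c * (a i - a j) - ε ≤ φ j - φ i) :
    c / 2 * ∑ j, (a (π j) - a j) ^ 2 - ε * ∑ j, |a (π j) - a j| ≤
      ∑ j, φ j * (a (π j) - a j) := by
  classical
  have hne : ∀ j, (Finset.univ.filter fun i => a j ≤ a i).Nonempty := fun j => ⟨j, by simp⟩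
  -- The monotone envelope of `φ + c * a`: it is nonincreasing along `a`, so the classical
  -- rearrangement inequality applies to it, and it stays within `ε` above `φ + c * a`.
  set g : ι → ℝ := fun j =>
    (Finset.univ.filter fun i => a j ≤ a i).sup' (hne j) (fun i => φ i + c * a i) with hg
  have hg1 : ∀ j, φ j + c * a j ≤ g j := fun j =>
    Finset.le_sup' (fun i => φ i + c * a i) (by simp)
  have hg2 : ∀ j, g j ≤ φ j + c * a j + ε := by
    intro j
    refine Finset.sup'_le _ _ fun i hi => ?_
    have := h i j (Finset.mem_filter.1 hi).2
    linarith
  have hanti : Antivary g a := by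
    intro i j hij
    refine Finset.sup'_le _ _ fun l hl => Finset.le_sup' (fun i => φ i + c * a i) ?_
    simp only [Finset.mem_filter, Finset.mem_univ, true_and] at hl ⊢
    linarith
  have h1 : 0 ≤ ∑ j, g j * (a (π j) - a j) := by
    have := hanti.sum_mul_le_sum_mul_comp_perm (σ := π)
    simp only [mul_sub, Finset.sum_sub_distrib]
    linarith
  have h2 : ∑ j, (g j - (φ j + c * a j)) * (a (π j) - a j) ≤ ε * ∑ j, |a (π j) - a j| := by
    rw [Finset.mul_sum]
    refine Finset.sum_le_sum fun j _ => ?_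
    have h3 := hg1 j
    have h4 := hg2 j
    calc _ ≤ |(g j - (φ j + c * a j)) * (a (π j) - a j)| := le_abs_self _
      _ = (g j - (φ j + c * a j)) * |a (π j) - a j| := by
        rw [abs_mul, abs_of_nonneg (by linarith)]
      _ ≤ _ := by gcongr; linarith
  -- A permutation preserves the sum of squares; this identity turns the slope `c` into the
  -- quadratic gain.
  have h3 : ∑ j, a j * (a (π j) - a j) = - (1 / 2) * ∑ j, (a (π j) - a j) ^ 2 := by
    have h4 : ∑ j, a (π j) ^ 2 = ∑ j, a j ^ 2 := Equiv.sum_comp π fun j => a j ^ 2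
    have h5 : ∑ j, (a (π j) - a j) ^ 2 = 2 * ∑ j, a j ^ 2 - 2 * ∑ j, a j * a (π j) := by
      rw [two_mul, ← h4]
      conv_rhs => rw [h4, ← h4]
      simp only [sub_sq, Finset.sum_add_distrib, Finset.sum_sub_distrib]
      rw [h4, Finset.mul_sum]
      have : ∑ j, 2 * a (π j) * a j = ∑ j, 2 * (a j * a (π j)) :=
        Finset.sum_congr rfl fun _ _ => by ring
      rw [this]; ring
    have h6 : ∑ j, a j * (a (π j) - a j) = ∑ j, a j * a (π j) - ∑ j, a j ^ 2 := by
      rw [← Finset.sum_sub_distrib]; exact Finset.sum_congr rfl fun _ _ => by ring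
    rw [h5, h6]; ring
  have h4 : ∑ j, (g j - (φ j + c * a j)) * (a (π j) - a j) = ∑ j, g j * (a (π j) - a j)
      - ∑ j, φ j * (a (π j) - a j) - c * ∑ j, a j * (a (π j) - a j) := by
    rw [Finset.mul_sum, ← Finset.sum_sub_distrib, ← Finset.sum_sub_distrib]
    exact Finset.sum_congr rfl fun _ _ => by ring
  rw [h3] at h4
  linarith

/-- For a function on the circle which decreases with the distance to `y i`, the distances of
regular positions `y` are the best aligned among those of all regular positions `x`. -/
lemma pairwise_gap {ι : Type*} [Fintype ι] (hι : Fintype.card ι ≠ 0) {x y : ι → Circle}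
    (hx : x ∈ regularPositions ι) (hy : y ∈ regularPositions ι) (φ : ι → ℝ) (i : ι) {c ε : ℝ}
    (h : ∀ j l, geoDist (y i) (y l) ≤ geoDist (y i) (y j) →
      c * (geoDist (y i) (y j) - geoDist (y i) (y l)) - ε ≤ φ l - φ j) :
    c / 2 * ∑ j, (geoDist (x i) (x j) - geoDist (y i) (y j)) ^ 2
        - ε * ∑ j, |geoDist (x i) (x j) - geoDist (y i) (y j)| ≤
      ∑ j, φ j * (geoDist (x i) (x j) - geoDist (y i) (y j)) := by
  -- Multiplication by this root of unity sends `x i` to `y i` and permutes the grid, so the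
  -- distances from `x i` are the distances from `y i` in another order.
  have hc : (y i * (x i)⁻¹) ^ Fintype.card ι = 1 := by
    rw [mul_pow, inv_pow, ((mem_regularPositions_iff hι).1 hx).2,
      ((mem_regularPositions_iff hι).1 hy).2]; simp
  obtain ⟨π, hπ⟩ := exists_perm_mul hι hy hx hc
  have h1 : ∀ j, geoDist (x i) (x j) = geoDist (y i) (y (π j)) := by
    intro j
    rw [hπ, ← geoDist_mul_left (y i * (x i)⁻¹) (x i) (x j)]
    simp
  simp only [h1]
  exact rearrangement_gap (fun j => geoDist (y i) (y j)) φ π h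

/-- For a function on the circle which decreases with the distance to `z₀`, the distances to `z₀`
are the best aligned among those to the points `z` of the grid. -/
lemma pointwise_gap {ι : Type*} [Fintype ι] (hι : Fintype.card ι ≠ 0) {w : ι → Circle}
    (hw : w ∈ regularPositions ι) {z z₀ : Circle} (hz : z ^ Fintype.card ι = 1)
    (hz₀ : z₀ ^ Fintype.card ι = 1) (φ : ι → ℝ) {c ε : ℝ}
    (h : ∀ j l, geoDist z₀ (w l) ≤ geoDist z₀ (w j) →
      c * (geoDist z₀ (w j) - geoDist z₀ (w l)) - ε ≤ φ l - φ j) :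
    c / 2 * ∑ j, (geoDist z (w j) - geoDist z₀ (w j)) ^ 2
        - ε * ∑ j, |geoDist z (w j) - geoDist z₀ (w j)| ≤
      ∑ j, φ j * (geoDist z (w j) - geoDist z₀ (w j)) := by
  have hc : (z₀ * z⁻¹) ^ Fintype.card ι = 1 := by
    rw [mul_pow, inv_pow, hz, hz₀]; simp
  obtain ⟨π, hπ⟩ := exists_perm_mul hι hw hw hc
  have h1 : ∀ j, geoDist z (w j) = geoDist z₀ (w (π j)) := by
    intro j
    rw [hπ, ← geoDist_mul_left (z₀ * z⁻¹) z (w j)]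
    simp
  simp only [h1]
  exact rearrangement_gap (fun j => geoDist z₀ (w j)) φ π h

/-! ### Second moments of regular positions -/

/-- The grid is a tight frame of the plane: squaring a real part leaves a constant plus a second
harmonic, and the latter sums to zero once the grid has at least three points. -/
lemma sum_re_mul_conj_sq {ι : Type*} [Fintype ι] {w : ι → Circle} (hw : w ∈ regularPositions ι)
    (hι : 3 ≤ Fintype.card ι) (u : ℂ) :
    ∑ j, (u * conj (w j : ℂ)).re ^ 2 = Fintype.card ι / 2 * ‖u‖ ^ 2 := by
  have h := sum_pow_regularPositions hw (m := 2) (by norm_num) (by omega)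
  have h1 : ∀ j, (u * conj (w j : ℂ)).re ^ 2 =
      1 / 2 * ‖u‖ ^ 2 + 1 / 2 * (u ^ 2 * conj ((w j : ℂ) ^ 2)).re := by
    intro j
    have h2 : Complex.normSq (w j : ℂ) = 1 := Circle.normSq_coe _
    rw [← Complex.normSq_eq_norm_sq]
    rw [Complex.normSq_apply] at h2 ⊢
    simp only [pow_two, map_mul, Complex.mul_re, Complex.mul_im, Complex.conj_re, Complex.conj_im]
    linear_combination ((u.re ^ 2 + u.im ^ 2) / 2) * h2
  rw [Finset.sum_congr rfl fun j _ => h1 j, Finset.sum_add_distrib, ← Finset.mul_sum,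
    ← Finset.mul_sum, ← Complex.re_sum, ← Finset.mul_sum, ← map_sum, h]
  simp; ring

/-- The cosine is 1-Lipschitz, so differences of distances dominate the inner products of `z - z₀`
with the grid; the tight frame identity sums their squares, and an arc is at most `π / 2` times its
chord. -/
lemma sum_sq_geoDist_sub_ge {ι : Type*} [Fintype ι] {w : ι → Circle}
    (hw : w ∈ regularPositions ι) (hι : 3 ≤ Fintype.card ι) (z z₀ : Circle) :
    2 / Real.pi ^ 2 * Fintype.card ι * geoDist z z₀ ^ 2 ≤
      ∑ j, (geoDist z (w j) - geoDist z₀ (w j)) ^ 2 := by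
  have h1 := sum_re_mul_conj_sq hw hι ((z : ℂ) - z₀)
  have h2 : ∑ j, (((z : ℂ) - z₀) * conj (w j : ℂ)).re ^ 2 ≤
      ∑ j, (geoDist z (w j) - geoDist z₀ (w j)) ^ 2 := by
    refine Finset.sum_le_sum fun j _ => ?_
    rw [sub_mul, Complex.sub_re, ← cos_geoDist, ← cos_geoDist, sq_le_sq]
    exact Real.abs_cos_sub_cos_le _ _
  have h3 := geoDist_le_norm_sub z z₀
  have h4 : geoDist z z₀ ^ 2 ≤ (Real.pi / 2 * ‖(z : ℂ) - z₀‖) ^ 2 := by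
    gcongr; exact geoDist_nonneg _ _
  calc _ ≤ 2 / Real.pi ^ 2 * Fintype.card ι * (Real.pi / 2 * ‖(z : ℂ) - z₀‖) ^ 2 := by gcongr
    _ = Fintype.card ι / 2 * ‖(z : ℂ) - z₀‖ ^ 2 := by field_simp
    _ ≤ _ := h1 ▸ h2

/-! ### Alignment of two tuples of regular positions -/

/-- After a suitable rotation of `x` and of `y`, both sums are real and nonnegative and add up to
twice a sum of products of real parts. The inequality `2ab ≤ a² + b²` and the tight frame identity
bound it by `k/2 + k/2`. -/
lemma norm_add_norm_sum_le {ι : Type*} [Fintype ι] {x y : ι → Circle}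
    (hx : x ∈ regularPositions ι) (hy : y ∈ regularPositions ι) (hι : 3 ≤ Fintype.card ι) :
    ‖∑ j, (x j : ℂ) * conj (y j : ℂ)‖ + ‖∑ j, (x j : ℂ) * (y j : ℂ)‖ ≤ Fintype.card ι := by
  set α := ∑ j, (x j : ℂ) * conj (y j : ℂ)
  set β := ∑ j, (x j : ℂ) * (y j : ℂ)
  -- The phases solve `s * conj t = exp(-i arg α)` and `s * t = exp(-i arg β)`.
  set s : Circle := Circle.exp (-(α.arg + β.arg) / 2)
  set t : Circle := Circle.exp ((α.arg - β.arg) / 2)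
  have key : ∀ z : ℂ, (Circle.exp (-z.arg) : ℂ) * z = ‖z‖ := by
    intro z
    conv_lhs => rw [← Complex.norm_mul_exp_arg_mul_I z]
    rw [Circle.coe_exp, mul_left_comm, ← Complex.exp_add]
    simp
  have hα : ((s : ℂ) * conj (t : ℂ)) * α = ‖α‖ := by
    rw [← key α, ← Circle.coe_inv_eq_conj, ← Circle.coe_mul, ← Circle.exp_neg, ← Circle.exp_add]
    congr 3; ring
  have hβ : ((s : ℂ) * (t : ℂ)) * β = ‖β‖ := by
    rw [← key β, ← Circle.coe_mul, ← Circle.exp_add]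
    congr 3; ring
  have h1 : ‖α‖ + ‖β‖ = ∑ j, 2 * ((conj (s : ℂ) * conj (x j : ℂ)).re *
      (conj (t : ℂ) * conj (y j : ℂ)).re) := by
    have : (‖α‖ : ℝ) + ‖β‖ = (((s : ℂ) * conj (t : ℂ)) * α + ((s : ℂ) * (t : ℂ)) * β).re := by
      rw [hα, hβ]; simp
    rw [this, Finset.mul_sum, Finset.mul_sum, ← Finset.sum_add_distrib, Complex.re_sum]
    refine Finset.sum_congr rfl fun j _ => ?_
    simp only [Complex.add_re, Complex.mul_re, Complex.mul_im, Complex.conj_re, Complex.conj_im]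
    ring
  have h2 := sum_re_mul_conj_sq hx hι (conj (s : ℂ))
  have h3 := sum_re_mul_conj_sq hy hι (conj (t : ℂ))
  rw [h1]
  calc _ ≤ ∑ j, ((conj (s : ℂ) * conj (x j : ℂ)).re ^ 2 +
      (conj (t : ℂ) * conj (y j : ℂ)).re ^ 2) :=
        Finset.sum_le_sum fun j _ => by
          have := two_mul_le_add_sq (conj (s : ℂ) * conj (x j : ℂ)).re
            (conj (t : ℂ) * conj (y j : ℂ)).re
          linarith
    _ = _ := by
      rw [Finset.sum_add_distrib, h2, h3, RCLike.norm_conj, RCLike.norm_conj, Circle.norm_coe,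
        Circle.norm_coe]
      ring

/-- Expanding the square, each Gram matrix contributes `k²/2` by the tight frame identity. In the
cross term, `2 cos a cos b = cos (a - b) + cos (a + b)` produces the two correlations. -/
lemma sum_sq_re_sub {ι : Type*} [Fintype ι] {x y : ι → Circle}
    (hx : x ∈ regularPositions ι) (hy : y ∈ regularPositions ι) (hι : 3 ≤ Fintype.card ι) :
    ∑ i, ∑ j, (((x i : ℂ) * conj (x j : ℂ)).re - ((y i : ℂ) * conj (y j : ℂ)).re) ^ 2 =
      (Fintype.card ι : ℝ) ^ 2 - ‖∑ j, (x j : ℂ) * conj (y j : ℂ)‖ ^ 2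
        - ‖∑ j, (x j : ℂ) * (y j : ℂ)‖ ^ 2 := by
  set k : ℝ := (Fintype.card ι : ℝ)
  have hsq : ∀ {w : ι → Circle}, w ∈ regularPositions ι →
      ∑ i, ∑ j, ((w i : ℂ) * conj (w j : ℂ)).re ^ 2 = k ^ 2 / 2 := by
    intro w hw
    rw [Finset.sum_congr rfl fun i _ => sum_re_mul_conj_sq hw hι (w i : ℂ)]
    simp [Circle.norm_coe, k]; ring
  have hexp : ∀ v : ι → ℂ, ‖∑ j, v j‖ ^ 2 = ∑ i, ∑ j, (v i * conj (v j)).re := by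
    intro v
    have : ((‖∑ j, v j‖ ^ 2 : ℝ) : ℂ) = ∑ i, ∑ j, v i * conj (v j) := by
      rw [← Finset.sum_mul_sum, ← map_sum, Complex.mul_conj, Complex.normSq_eq_norm_sq]
    have h2 := congrArg Complex.re this
    rw [Complex.ofReal_re] at h2
    simp only [h2, Complex.re_sum]
  have hcross : ∑ i, ∑ j, ((x i : ℂ) * conj (x j : ℂ)).re * ((y i : ℂ) * conj (y j : ℂ)).re =
      1 / 2 * (‖∑ j, (x j : ℂ) * conj (y j : ℂ)‖ ^ 2 + ‖∑ j, (x j : ℂ) * (y j : ℂ)‖ ^ 2) := by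
    rw [hexp, hexp, ← Finset.sum_add_distrib, Finset.mul_sum]
    refine Finset.sum_congr rfl fun i _ => ?_
    rw [← Finset.sum_add_distrib, Finset.mul_sum]
    refine Finset.sum_congr rfl fun j _ => ?_
    simp only [map_mul, Complex.mul_re, Complex.mul_im, Complex.conj_re, Complex.conj_im,
      Complex.conj_conj]
    ring
  have h1 : ∑ i, ∑ j, (((x i : ℂ) * conj (x j : ℂ)).re - ((y i : ℂ) * conj (y j : ℂ)).re) ^ 2 =
      ∑ i, ∑ j, ((x i : ℂ) * conj (x j : ℂ)).re ^ 2 +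
      ∑ i, ∑ j, ((y i : ℂ) * conj (y j : ℂ)).re ^ 2 -
      2 * ∑ i, ∑ j, ((x i : ℂ) * conj (x j : ℂ)).re * ((y i : ℂ) * conj (y j : ℂ)).re := by
    simp only [Finset.mul_sum, ← Finset.sum_add_distrib, ← Finset.sum_sub_distrib]
    exact Finset.sum_congr rfl fun i _ => Finset.sum_congr rfl fun j _ => by ring
  rw [h1, hsq hx, hsq hy, hcross]
  ring

/-- Regular positions with close pairwise distances are close up to an isometry of the circle. -/
lemma exists_alignment {ι : Type*} [Fintype ι] {x y : ι → Circle}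
    (hx : x ∈ regularPositions ι) (hy : y ∈ regularPositions ι) (hι : 3 ≤ Fintype.card ι) :
    ∃ Q : ℂ ≃ₗᵢ[ℝ] ℂ, Fintype.card ι * ∑ j, ‖(x j : ℂ) - act Q (y j)‖ ^ 2 ≤
      2 * ∑ i, ∑ j, (geoDist (x i) (x j) - geoDist (y i) (y j)) ^ 2 := by
  set k : ℝ := (Fintype.card ι : ℝ) with hk
  set α := ∑ j, (x j : ℂ) * conj (y j : ℂ) with hα
  set β := ∑ j, (x j : ℂ) * (y j : ℂ) with hβ
  have hsum : ‖α‖ + ‖β‖ ≤ k := norm_add_norm_sum_le hx hy hι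
  have hgram := sum_sq_re_sub hx hy hι
  rw [← hα, ← hβ, ← hk] at hgram
  have hle : k ^ 2 - ‖α‖ ^ 2 - ‖β‖ ^ 2 ≤
      ∑ i, ∑ j, (geoDist (x i) (x j) - geoDist (y i) (y j)) ^ 2 := by
    rw [← hgram]
    refine Finset.sum_le_sum fun i _ => Finset.sum_le_sum fun j _ => ?_
    rw [← cos_geoDist, ← cos_geoDist, sq_le_sq]
    exact Real.abs_cos_sub_cos_le _ _
  have key : ∀ z : ℂ, (z * conj (Circle.exp z.arg : ℂ)) = ‖z‖ := by
    intro z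
    conv_lhs => rw [← Complex.norm_mul_exp_arg_mul_I z]
    rw [← Circle.coe_inv_eq_conj, ← Circle.exp_neg, Circle.coe_exp, mul_assoc, ← Complex.exp_add]
    simp
  have hnorm : ∀ Q : ℂ ≃ₗᵢ[ℝ] ℂ, ∑ j, ‖(x j : ℂ) - act Q (y j)‖ ^ 2 =
      2 * k - 2 * (∑ j, (x j : ℂ) * conj (act Q (y j) : ℂ)).re := by
    intro Q
    rw [Finset.sum_congr rfl fun j _ => norm_sub_sq_circle _ _, Finset.sum_sub_distrib,
      ← Finset.mul_sum, Complex.re_sum]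
    simp [k, mul_comm]
  have hk0 : 0 ≤ k := by positivity
  -- The larger correlation decides between rotation and reflection. If it is `α`, then `|α|² + |β|²
  -- ≤ |α| (|α| + |β|) ≤ k |α|`, which is the required comparison; the other case is symmetric.
  rcases le_total ‖β‖ ‖α‖ with h | h
  · refine ⟨rotation (Circle.exp α.arg), ?_⟩
    have h1 : ∑ j, (x j : ℂ) * conj (act (rotation (Circle.exp α.arg)) (y j) : ℂ) = ‖α‖ := by
      rw [← key α, hα, Finset.sum_mul]
      refine Finset.sum_congr rfl fun j _ => ?_
      rw [act_rotation, Circle.coe_mul, map_mul]; ring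
    rw [hnorm, h1, Complex.ofReal_re]
    nlinarith [norm_nonneg α, norm_nonneg β]
  · refine ⟨Complex.conjLIE.trans (rotation (Circle.exp β.arg)), ?_⟩
    have h1 : ∑ j, (x j : ℂ) * conj (act (Complex.conjLIE.trans
        (rotation (Circle.exp β.arg))) (y j) : ℂ) = ‖β‖ := by
      rw [← key β, hβ, Finset.sum_mul]
      refine Finset.sum_congr rfl fun j _ => ?_
      rw [act_conj_rotation, Circle.coe_mul, map_mul, Circle.coe_inv_eq_conj, Complex.conj_conj]
      ring
    rw [hnorm, h1, Complex.ofReal_re]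
    nlinarith [norm_nonneg α, norm_nonneg β]

/-- Cauchy–Schwarz passes from the quadratic to the summed error, the form in which the refinement
uses it; the constant covers `(π / 2) √2`. -/
lemma exists_alignment_geoDist {ι : Type*} [Fintype ι] {x y : ι → Circle}
    (hx : x ∈ regularPositions ι) (hy : y ∈ regularPositions ι) (hι : 3 ≤ Fintype.card ι) :
    ∃ Q : ℂ ≃ₗᵢ[ℝ] ℂ, ∑ j, geoDist (x j) (act Q (y j)) ≤
      3 * √(∑ i, ∑ j, (geoDist (x i) (x j) - geoDist (y i) (y j)) ^ 2) := by
  obtain ⟨Q, hQ⟩ := exists_alignment hx hy hι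
  refine ⟨Q, ?_⟩
  set N := ∑ i, ∑ j, (geoDist (x i) (x j) - geoDist (y i) (y j)) ^ 2
  have hN : 0 ≤ N := Finset.sum_nonneg fun _ _ => Finset.sum_nonneg fun _ _ => sq_nonneg _
  have h1 : ∑ j, geoDist (x j) (act Q (y j)) ≤
      Real.pi / 2 * ∑ j, ‖(x j : ℂ) - act Q (y j)‖ := by
    rw [Finset.mul_sum]; exact Finset.sum_le_sum fun j _ => geoDist_le_norm_sub _ _
  have h2 : (∑ j, ‖(x j : ℂ) - act Q (y j)‖) ^ 2 ≤
      Fintype.card ι * ∑ j, ‖(x j : ℂ) - act Q (y j)‖ ^ 2 := by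
    simpa using sq_sum_le_card_mul_sum_sq (s := Finset.univ)
      (f := fun j => ‖(x j : ℂ) - act Q (y j)‖)
  have h3 : ∑ j, ‖(x j : ℂ) - act Q (y j)‖ ≤ √2 * √N := by
    rw [← Real.sqrt_mul (by norm_num)]
    exact Real.le_sqrt_of_sq_le (h2.trans hQ)
  have h4 : √2 ≤ 3 / 2 := by rw [Real.sqrt_le_left] <;> norm_num
  calc _ ≤ Real.pi / 2 * (√2 * √N) := h1.trans (by gcongr)
    _ ≤ 4 / 2 * (3 / 2 * √N) := by gcongr; exact Real.pi_le_four
    _ = _ := by ring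

/-! ### Bi-Lipschitz affinities -/

lemma slack_nonneg {n : ℕ} {ce : ℝ} (hce : 0 ≤ ce) : 0 ≤ slack n ce := by
  unfold slack; positivity

lemma IsBiLipschitz.abs_sub_le {n : ℕ} {cl cL ce : ℝ} {f : Circle → Circle → ℝ}
    (hf : IsBiLipschitz n cl cL ce f) (x x' y y' : Circle) :
    |f x y - f x' y'| ≤ cL * (geoDist x x' + geoDist y y') + 2 * slack n ce := by
  have h1 := hf.upper x y y'
  have h2 := hf.upper y' x x'
  rw [hf.symm y' x, hf.symm y' x'] at h2
  calc |f x y - f x' y'| = |(f x y - f x y') + (f x y' - f x' y')| := by ring_nf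
    _ ≤ _ := (abs_add_le _ _).trans (by linarith)

/-- The mean-zero part of the observation matrix. -/
def noiseMatrix {n : ℕ} (e : UpperPair n → ℝ) (i j : Fin n) : ℝ := observation (fun _ _ => 0) e i j

/-- The signal plus noise decomposition holds in every representation, not only the one generating
the data, so the analysis may use one close to regular positions. -/
lemma observation_eq {n : ℕ} {cl cL ce : ℝ} {F : Fin n → Fin n → ℝ}
    {p : (Fin n → Circle) × (Circle → Circle → ℝ)} (hp : p ∈ reps cl cL ce F)
    (e : UpperPair n → ℝ) {i j : Fin n} (hij : i ≠ j) :
    observation F e i j = p.2 (p.1 i) (p.1 j) + noiseMatrix e i j := by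
  unfold noiseMatrix observation
  rcases lt_or_gt_of_ne hij with h | h
  · simp [h, hp.2 i j h]
  · simp [h, h.not_gt, ← hp.2 j i h, hp.1.symm (p.1 i) (p.1 j)]

/-! ### The initial localization -/

/-- Deterministic error bound for the initial localization, in terms of pairwise distances. -/
lemma localization_bound {ι : Type*} [Fintype ι] (hι : Fintype.card ι ≠ 0) {n : ℕ}
    {cl cL ce : ℝ} (hcL : 0 ≤ cL) (hce : 0 ≤ ce) {f : Circle → Circle → ℝ}
    (hf : IsBiLipschitz n cl cL ce f) {A W : ι → ι → ℝ} {x y u : ι → Circle}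
    (hA : ∀ i j, i ≠ j → A i j = f (x i) (x j) + W i j) {δ τ : ℝ}
    (hxy : ∀ i, geoDist (x i) (y i) ≤ δ) (hu : u ∈ regularPositions ι)
    (hy : y ∈ regularPositions ι) (hmin : initCriterion A u ≤ initCriterion A y)
    (hW : -∑ i, ∑ j, W i j * (geoDist (u i) (u j) - geoDist (y i) (y j)) ≤
      τ * √(∑ i, ∑ j, (geoDist (u i) (u j) - geoDist (y i) (y j)) ^ 2)) (hτ : 0 ≤ τ)
    (hδ : 0 ≤ δ) :
    cl / 2 * √(∑ i, ∑ j, (geoDist (u i) (u j) - geoDist (y i) (y j)) ^ 2) ≤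
      (2 * cL * δ + 3 * slack n ce) * Fintype.card ι + τ := by
  set H : ι → ι → ℝ := fun i j => geoDist (u i) (u j) - geoDist (y i) (y j) with hH
  have hdiag : ∀ i, H i i = 0 := fun i => by simp [hH]
  set N := √(∑ i, ∑ j, H i j ^ 2) with hN
  have hS : 0 ≤ ∑ i, ∑ j, H i j ^ 2 :=
    Finset.sum_nonneg fun _ _ => Finset.sum_nonneg fun _ _ => sq_nonneg _
  have hNN : N ^ 2 = ∑ i, ∑ j, H i j ^ 2 := Real.sq_sqrt hS
  have hN0 : 0 ≤ N := Real.sqrt_nonneg _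
  have hε : 0 ≤ slack n ce := slack_nonneg hce
  have hl1 : ∑ i, ∑ j, |H i j| ≤ Fintype.card ι * N := by
    refine abs_le_of_sq_le_sq' ?_ (by positivity) |>.2
    rw [mul_pow, hNN]
    have := sq_sum_le_card_mul_sum_sq (s := (Finset.univ : Finset (ι × ι)))
      (f := fun p => |H p.1 p.2|)
    simpa [Fintype.sum_prod_type, ← pow_two] using this
  have h1 : ∑ i, ∑ j, A i j * H i j ≤ 0 := by
    unfold initCriterion at hmin
    simp only [hH, mul_sub, Finset.sum_sub_distrib]
    linarith
  -- Moves the affinity from `x` to the regular positions `y` at a Lipschitz cost. The diagonal of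
  -- `A` does not follow the model, but it is multiplied by zero.
  have h2 : ∀ i j, f (y i) (y j) * H i j + W i j * H i j - (2 * cL * δ + 2 * slack n ce) * |H i j|
      ≤ A i j * H i j := by
    intro i j
    rcases eq_or_ne i j with rfl | hij
    · simp [hdiag]
    · have h3 := hf.abs_sub_le (y i) (x i) (y j) (x j)
      have h4 : |f (y i) (y j) - f (x i) (x j)| ≤ 2 * cL * δ + 2 * slack n ce := by
        refine h3.trans ?_
        have h5 := hxy i
        have h6 := hxy j
        rw [geoDist_comm] at h5 h6
        have : cL * (geoDist (y i) (x i) + geoDist (y j) (x j)) ≤ cL * (δ + δ) := by gcongr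
        linarith
      have h7 : (f (y i) (y j) - f (x i) (x j)) * H i j ≤
          (2 * cL * δ + 2 * slack n ce) * |H i j| := by
        refine (le_abs_self _).trans ?_
        rw [abs_mul]; gcongr
      rw [hA i j hij]
      linarith
  have h3 : ∑ i, ∑ j, f (y i) (y j) * H i j + ∑ i, ∑ j, W i j * H i j
      - (2 * cL * δ + 2 * slack n ce) * ∑ i, ∑ j, |H i j| ≤ 0 := by
    refine le_trans ?_ h1
    rw [Finset.mul_sum, ← Finset.sum_add_distrib, ← Finset.sum_sub_distrib]
    refine Finset.sum_le_sum fun i _ => ?_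
    rw [Finset.mul_sum, ← Finset.sum_add_distrib, ← Finset.sum_sub_distrib]
    exact Finset.sum_le_sum fun j _ => h2 i j
  have h4 : cl / 2 * ∑ i, ∑ j, H i j ^ 2 - slack n ce * ∑ i, ∑ j, |H i j| ≤
      ∑ i, ∑ j, f (y i) (y j) * H i j := by
    rw [Finset.mul_sum, Finset.mul_sum, ← Finset.sum_sub_distrib]
    exact Finset.sum_le_sum fun i _ =>
      pairwise_gap hι hu hy (fun j => f (y i) (y j)) i fun j l h => hf.lower _ _ _ h
  -- Quadratic gain against linear errors. The third `slack` comes from the rearrangement gap, the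
  -- other two from the change of positions.
  have h5 : cl / 2 * N * N ≤ ((2 * cL * δ + 3 * slack n ce) * Fintype.card ι + τ) * N := by
    have h6 : (2 * cL * δ + 3 * slack n ce) * ∑ i, ∑ j, |H i j| ≤
        (2 * cL * δ + 3 * slack n ce) * (Fintype.card ι * N) := by gcongr
    rw [← hNN] at h4
    nlinarith
  rcases hN0.eq_or_lt with h0 | h0
  · rw [← h0, mul_zero]; positivity
  · exact le_of_mul_le_mul_right h5 h0

/-! ### The refinement -/

/-- Deterministic error bound for the refined estimator of a single position. -/
lemma refinement_bound {ι : Type*} [Fintype ι] (hι : 3 ≤ Fintype.card ι) {n : ℕ}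
    {cl cL ce : ℝ} (hcl : 0 ≤ cl) (hcL : 0 ≤ cL) (hce : 0 ≤ ce) {f : Circle → Circle → ℝ}
    (hf : IsBiLipschitz n cl cL ce f) {a W : ι → ℝ} {x u : ι → Circle} {p z z₀ : Circle}
    (ha : ∀ j, a j = f p (x j) + W j) (hu : u ∈ regularPositions ι)
    (hz : z ^ Fintype.card ι = 1) (hz₀ : z₀ ^ Fintype.card ι = 1)
    (hmin : ∑ j, a j * geoDist z (u j) ≤ ∑ j, a j * geoDist z₀ (u j))
    (Q : ℂ ≃ₗᵢ[ℝ] ℂ) {γ δ τ : ℝ} (hp : geoDist z₀ (act Q p) ≤ γ)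
    (hux : ∑ j, geoDist (u j) (act Q (x j)) ≤ Fintype.card ι * δ) (hτ : 0 ≤ τ)
    (hW : -∑ j, W j * (geoDist z (u j) - geoDist z₀ (u j)) ≤
      τ * √(∑ j, (geoDist z (u j) - geoDist z₀ (u j)) ^ 2)) :
    cl / Real.pi ^ 2 * Fintype.card ι * geoDist z z₀ ≤
      (cL * (γ + δ) + 3 * slack n ce) * Fintype.card ι + τ * √(Fintype.card ι) := by
  set k : ℝ := (Fintype.card ι : ℝ) with hk
  have hk0 : 0 < k := by simp only [hk, Nat.cast_pos]; omega
  set h : ι → ℝ := fun j => geoDist z (u j) - geoDist z₀ (u j) with hh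
  set D := geoDist z z₀ with hD
  have hD0 : 0 ≤ D := geoDist_nonneg _ _
  have hε : 0 ≤ slack n ce := slack_nonneg hce
  have hγ : 0 ≤ γ := (geoDist_nonneg _ _).trans hp
  have habs : ∀ j, |h j| ≤ D := fun j => abs_geoDist_sub_le _ _ _
  have hl1 : ∑ j, |h j| ≤ k * D := by
    calc _ ≤ ∑ _j : ι, D := Finset.sum_le_sum fun j _ => habs j
      _ = _ := by simp [hk]
  have hl2 : √(∑ j, h j ^ 2) ≤ √k * D := by
    rw [Real.sqrt_le_left (by positivity), mul_pow, Real.sq_sqrt hk0.le]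
    calc _ ≤ ∑ _j : ι, D ^ 2 := Finset.sum_le_sum fun j _ => by
            rw [← sq_abs]; gcongr; exact habs j
      _ = _ := by simp [hk]
  have hmin' : ∑ j, a j * h j ≤ 0 := by
    simp only [hh, mul_sub, Finset.sum_sub_distrib]; linarith
  -- The ideal affinity profile in the frame of the estimator: `Q` is undone, and the grid points
  -- `z₀` and `u j` stand for `p` and `x j`.
  set φ : ι → ℝ := fun j => f (act Q.symm z₀) (act Q.symm (u j)) with hφ
  have hgap : cl / 2 * ∑ j, h j ^ 2 - slack n ce * ∑ j, |h j| ≤ ∑ j, φ j * h j := by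
    refine pointwise_gap (by omega) hu hz hz₀ φ fun j l hjl => ?_
    have := hf.lower (act Q.symm z₀) (act Q.symm (u j)) (act Q.symm (u l))
    simp only [geoDist_act] at this
    exact this hjl
  have hdist : ∀ j, |φ j - f p (x j)| ≤
      cL * (γ + geoDist (u j) (act Q (x j))) + 2 * slack n ce := by
    intro j
    refine (hf.abs_sub_le _ _ _ _).trans ?_
    have h1 : geoDist (act Q.symm z₀) p = geoDist z₀ (act Q p) := by
      rw [← geoDist_act Q]; simp
    have h2 : geoDist (act Q.symm (u j)) (x j) = geoDist (u j) (act Q (x j)) := by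
      rw [← geoDist_act Q]; simp
    rw [h1, h2]; gcongr
  -- Since every `|h j|` is at most `D`, the errors of the initial positions enter only through
  -- their sum.
  have h2 : ∀ j, φ j * h j + W j * h j -
      (cL * (γ + geoDist (u j) (act Q (x j))) + 2 * slack n ce) * D ≤ a j * h j := by
    intro j
    have h7 : (φ j - f p (x j)) * h j ≤
        (cL * (γ + geoDist (u j) (act Q (x j))) + 2 * slack n ce) * D := by
      refine (le_abs_self _).trans ?_
      have := geoDist_nonneg (u j) (act Q (x j))
      rw [abs_mul]; gcongr
      exacts [hdist j, habs j]
    rw [ha j]; linarith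
  have h3 : ∑ j, φ j * h j + ∑ j, W j * h j - (cL * (γ + δ) + 2 * slack n ce) * k * D ≤ 0 := by
    have h4 : ∑ j, (cL * (γ + geoDist (u j) (act Q (x j))) + 2 * slack n ce) * D ≤
        (cL * (γ + δ) + 2 * slack n ce) * k * D := by
      rw [← Finset.sum_mul]
      gcongr
      rw [Finset.sum_add_distrib, ← Finset.mul_sum, Finset.sum_add_distrib]
      simp only [Finset.sum_const, Finset.card_univ, nsmul_eq_mul, ← hk]
      nlinarith [mul_le_mul_of_nonneg_left hux hcL]
    have h5 : ∑ j, φ j * h j + ∑ j, W j * h j -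
        ∑ j, (cL * (γ + geoDist (u j) (act Q (x j))) + 2 * slack n ce) * D ≤ ∑ j, a j * h j := by
      rw [← Finset.sum_add_distrib, ← Finset.sum_sub_distrib]
      exact Finset.sum_le_sum fun j _ => h2 j
    linarith
  have hspread := sum_sq_geoDist_sub_ge hu hι z z₀
  rw [← hD, ← hk] at hspread
  have h6 : cl / Real.pi ^ 2 * k * D * D ≤ cl / 2 * ∑ j, h j ^ 2 := by
    calc _ = cl / 2 * (2 / Real.pi ^ 2 * k * D ^ 2) := by field_simp
      _ ≤ _ := by gcongr
  have h7 : cl / Real.pi ^ 2 * k * D * D ≤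
      ((cL * (γ + δ) + 3 * slack n ce) * k + τ * √k) * D := by
    have h8 : τ * √(∑ j, h j ^ 2) ≤ τ * (√k * D) := by gcongr
    have h9 : slack n ce * ∑ j, |h j| ≤ slack n ce * (k * D) := by gcongr
    linarith
  rcases hD0.eq_or_lt with h0 | h0
  · have hδ : 0 ≤ δ := by
      have := (Finset.sum_nonneg fun j _ => geoDist_nonneg (u j) (act Q (x j))).trans hux
      exact nonneg_of_mul_nonneg_right this hk0
    rw [← h0, mul_zero]; positivity
  · exact le_of_mul_le_mul_right h7 h0

/-! ### One complete run: localization followed by refinement -/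

/-- The parametric rate `√(log n / n)`. -/
noncomputable def rate (n : ℕ) : ℝ := √(Real.log n / n)

lemma rate_nonneg (n : ℕ) : 0 ≤ rate n := Real.sqrt_nonneg _

lemma mul_rate_sq {n : ℕ} (hn : 0 < n) : n * rate n ^ 2 = Real.log n := by
  unfold rate
  rw [Real.sq_sqrt (div_nonneg (Real.log_natCast_nonneg n) (by positivity))]
  field_simp

lemma one_le_log {n : ℕ} (hn : 4 ≤ n) : 1 ≤ Real.log n := by
  rw [Real.le_log_iff_exp_le (by positivity)]
  have : (4 : ℝ) ≤ n := by exact_mod_cast hn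
  linarith [Real.exp_one_lt_d9]

lemma one_le_mul_rate {n : ℕ} (hn : 4 ≤ n) : 1 ≤ n * rate n := by
  have h1 := mul_rate_sq (n := n) (by omega)
  have h2 := one_le_log hn
  have h3 : (4 : ℝ) ≤ n := by exact_mod_cast hn
  have h4 := rate_nonneg n
  by_contra! h
  nlinarith

/-- The properties of the split `S` and of the noise used in one run of the procedure. -/
structure GoodRun {n : ℕ} (e : UpperPair n → ℝ) (S : Finset (Fin n)) (u : S → Circle)
    (y : Fin n → Circle) : Prop where
  spread : ∃ v ∈ regularPositions S, ∀ j : S, geoDist (y j) (v j) ≤ 96 * rate n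
  init : ∀ u ∈ regularPositions S, ∀ v ∈ regularPositions S,
    -∑ i : S, ∑ j : S, noiseMatrix e i j * (geoDist (u i) (u j) - geoDist (v i) (v j)) ≤
      3 * n * rate n * √(∑ i, ∑ j, (geoDist (u i) (u j) - geoDist (v i) (v j)) ^ 2)
  refined : ∀ i ∉ S, ∀ z ∈ grid (n / 4), ∀ z' ∈ grid (n / 4),
    -∑ j : S, noiseMatrix e i j * (geoDist z (u j) - geoDist z' (u j)) ≤
      8 * √n * rate n * √(∑ j, (geoDist z (u j) - geoDist z' (u j)) ^ 2)

/-- Error constant for the pairwise distances of the initial localization. -/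
noncomputable def initConst (cl cL ce : ℝ) : ℝ := 2 / cl * (2 * cL * 97 + 3 * ce + 12)

/-- Error constant of one run of the procedure. -/
noncomputable def runConst (cl cL ce : ℝ) : ℝ :=
  16 / cl * (cL * (16 + (3 * initConst cl cL ce + 97)) + 3 * ce + 16) + 16

lemma initConst_nonneg {cl cL ce : ℝ} (hcl : 0 < cl) (hcL : cl ≤ cL) (hce : 0 ≤ ce) :
    0 ≤ initConst cl cL ce := by
  have : 0 ≤ cL := by linarith
  unfold initConst; positivity

lemma runConst_pos {cl cL ce : ℝ} (hcl : 0 < cl) (hcL : cl ≤ cL) (hce : 0 ≤ ce) :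
    0 < runConst cl cL ce := by
  have : 0 ≤ cL := by linarith
  have := initConst_nonneg hcl hcL hce
  unfold runConst; positivity

/-- On a good run, the refined estimator is close to the true positions up to an isometry. -/
lemma GoodRun.exists_isometry {n k : ℕ} (hn : n = 4 * k) (hk : 3 ≤ k) {cl cL ce : ℝ}
    (hcl : 0 < cl) (hcL : cl ≤ cL) (hce : 0 ≤ ce) {F : Fin n → Fin n → ℝ}
    {p : (Fin n → Circle) × (Circle → Circle → ℝ)} (hp : p ∈ reps cl cL ce F)
    {e : UpperPair n → ℝ} {S : Finset (Fin n)} (hS : S.card = n / 4) (I : InitialEstimator n)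
    {y : Fin n → Circle} (hgood : GoodRun e S (I.toFun S (submatrix (observation F e) S)) y)
    {δ : ℝ} (hδ : ∀ i, geoDist (p.1 i) (y i) ≤ δ) (hr : rate n ≤ δ) {x2 : Fin n → Circle}
    (hx2 : IsRefined (observation F e) S (I.toFun S (submatrix (observation F e) S)) x2) :
    ∃ Q : ℂ ≃ₗᵢ[ℝ] ℂ, ∀ i ∉ S, geoDist (x2 i) (act Q (p.1 i)) ≤ runConst cl cL ce * δ := by
  have hcL0 : 0 ≤ cL := by linarith
  have hnk : n / 4 = k := by omega
  have hcard : Fintype.card S = k := by simp [hS, hnk]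
  have hr0 := rate_nonneg n
  have hδ0 : 0 ≤ δ := hr0.trans hr
  have hkr : (0 : ℝ) < k := by positivity [(by omega : 0 < k)]
  have hnk' : (n : ℝ) = 4 * k := by rw [hn]; push_cast; ring
  have hslack : slack n ce ≤ ce * δ := by unfold slack; gcongr; exact hr
  have hπ : Real.pi ≤ 4 := Real.pi_le_four
  set u := I.toFun S (submatrix (observation F e) S) with hu
  have hureg : u ∈ regularPositions S := I.regular _ _
  obtain ⟨v, hv, hyv⟩ := hgood.spread
  set x : S → Circle := fun j => p.1 j with hx
  -- `97 = 1 + 96`: the distance of the representation to `y`, plus that of `y` on `S` to regular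
  -- positions of `S`.
  have hxv : ∀ j : S, geoDist (x j) (v j) ≤ 97 * δ := fun j => by
    have := geoDist_triangle (x j) (y j) (v j)
    have h1 := hyv j
    have h2 := hδ j
    simp only [hx] at this ⊢
    linarith
  set N := √(∑ i, ∑ j, (geoDist (u i) (u j) - geoDist (v i) (v j)) ^ 2) with hN
  have hK1 : N ≤ initConst cl cL ce * (k * δ) := by
    have h1 := localization_bound (ι := S) (by omega) hcL0 hce hp.1
      (A := submatrix (observation F e) S)
      (W := fun i j => noiseMatrix e i j) (x := x) (y := v) (u := u)
      (fun i j hij => observation_eq hp e fun h => hij (Subtype.ext h)) hxv hureg hv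
      (I.minimal _ _ _ hv) (hgood.init u hureg v hv) (by positivity) (by positivity)
    rw [hcard, ← hN] at h1
    have h2 : (2 * cL * (97 * δ) + 3 * slack n ce) * k + 3 * n * rate n ≤
        (2 * cL * 97 + 3 * ce + 12) * (k * δ) := by
      have h3 : (k : ℝ) * rate n ≤ k * δ := by gcongr
      have h4 : slack n ce * k ≤ ce * δ * k := by gcongr
      rw [hnk']; linarith
    unfold initConst
    rw [mul_assoc, div_mul_eq_mul_div, le_div_iff₀ hcl]
    linarith
  obtain ⟨Q, hQ⟩ := exists_alignment_geoDist hureg hv (by omega)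
  refine ⟨Q, fun i hi => ?_⟩
  obtain ⟨hgrid, hmin⟩ := hx2 i hi
  rw [hnk] at hgrid hmin
  obtain ⟨z₀, hz₀, hz₀d⟩ := exists_grid_near (k := k) (by omega) (act Q (p.1 i))
  have hz₀g := (mem_grid_iff (k := k) (by omega)).2 hz₀
  -- Grid resolution: `π / k ≤ 4 / k ≤ 16 * rate n`, because `1 ≤ n * rate n` and `n = 4k`.
  have hγ : geoDist z₀ (act Q (p.1 i)) ≤ 16 * δ := by
    refine hz₀d.trans ?_
    rw [div_le_iff₀ hkr]
    have h1 := one_le_mul_rate (n := n) (by omega)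
    rw [hnk'] at h1
    have h3 : (k : ℝ) * rate n ≤ k * δ := by gcongr
    linarith
  have hsum : ∑ j, geoDist (u j) (act Q (x j)) ≤
      Fintype.card S * ((3 * initConst cl cL ce + 97) * δ) := by
    have h1 : ∑ j, geoDist (u j) (act Q (x j)) ≤
        ∑ j, (geoDist (u j) (act Q (v j)) + 97 * δ) := by
      refine Finset.sum_le_sum fun j _ => ?_
      have := geoDist_triangle (u j) (act Q (v j)) (act Q (x j))
      rw [geoDist_act, geoDist_comm (v j)] at this
      linarith [hxv j]
    rw [Finset.sum_add_distrib] at h1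
    simp only [Finset.sum_const, Finset.card_univ, nsmul_eq_mul, hcard] at h1
    rw [hcard]
    linarith
  have h1 := refinement_bound (ι := S) (by omega) hcl.le hcL0 hce hp.1
    (a := fun j => observation F e i j) (W := fun j => noiseMatrix e i j) (x := x) (u := u)
    (p := p.1 i) (z := x2 i) (z₀ := z₀)
    (fun j => observation_eq hp e fun h => hi (h ▸ j.2)) hureg
    (by rw [hcard]; exact (mem_grid_iff (by omega)).1 hgrid) (by rw [hcard]; exact hz₀)
    (hmin z₀ hz₀g) Q hγ hsum (τ := 8 * √n * rate n) (by positivity)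
    (hgood.refined i hi _ (hnk ▸ hgrid) _ (hnk ▸ hz₀g))
  rw [hcard] at h1
  have h2 : 8 * √n * rate n * √k = 16 * k * rate n := by
    rw [hnk', Real.sqrt_mul (by norm_num), show (4 : ℝ) = 2 ^ 2 by norm_num,
      Real.sqrt_sq (by norm_num)]
    have := Real.mul_self_sqrt hkr.le
    linear_combination 16 * rate n * this
  rw [h2] at h1
  set D := geoDist (x2 i) z₀
  have hD0 : 0 ≤ D := geoDist_nonneg _ _
  have h3 : cl / 16 * D * k ≤ cl / Real.pi ^ 2 * k * D := by
    have : cl / 16 ≤ cl / Real.pi ^ 2 := by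
      gcongr; nlinarith [Real.pi_pos]
    nlinarith [mul_nonneg hkr.le hD0]
  set B := cL * (16 + (3 * initConst cl cL ce + 97)) + 3 * ce + 16 with hB
  have h4 : cl / 16 * D ≤ B * δ := by
    refine le_of_mul_le_mul_right (h3.trans (h1.trans ?_)) hkr
    have h5 : (k : ℝ) * rate n ≤ k * δ := by gcongr
    have h6 : slack n ce * k ≤ ce * δ * k := by gcongr
    rw [hB]; linarith
  have h5 : D ≤ 16 / cl * B * δ := by
    have : D = 16 / cl * (cl / 16 * D) := by field_simp
    rw [this, mul_assoc]; gcongr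
  have h6 := geoDist_triangle (x2 i) z₀ (act Q (p.1 i))
  unfold runConst
  rw [← hB]; linarith

/-! ### Synchronization -/

/-- More than half of regular positions cannot be almost fixed by a reflection. -/
lemma not_reflection {n k : ℕ} (hn : n = 4 * k) (hk : 2 ≤ k) {y : Fin n → Circle}
    (hy : y ∈ regularPositions (Fin n)) {T : Finset (Fin n)} (hT : 2 * k ≤ T.card) (a : Circle)
    {s : ℝ} (hs : s ≤ 1 / 2) (h : ∀ i ∈ T, ‖(y i : ℂ) - (a * (y i)⁻¹ : Circle)‖ ≤ s) : False := by
  have h2 := sum_pow_regularPositions hy (m := 2) (by norm_num) (by simp; omega)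
  have h4 := sum_pow_regularPositions hy (m := 4) (by norm_num) (by simp; omega)
  -- The cosine of the angle between `y i` and its mirror image. Vanishing of the second and fourth
  -- harmonics gives `∑ c = 0` and `∑ c² = n / 2`.
  set c : Fin n → ℝ := fun i => (conj (a : ℂ) * (y i : ℂ) ^ 2).re with hc
  have hcT : ∀ i ∈ T, 7 / 8 ≤ c i := by
    intro i hi
    have h1 := norm_sub_sq_circle (y i) (a * (y i)⁻¹)
    have h3 : (y i : ℂ) * conj ((a * (y i)⁻¹ : Circle) : ℂ) = conj (a : ℂ) * (y i : ℂ) ^ 2 := by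
      rw [Circle.coe_mul, map_mul, Circle.coe_inv_eq_conj, Complex.conj_conj]; ring
    rw [h3] at h1
    have h5 := h i hi
    have h6 : ‖(y i : ℂ) - (a * (y i)⁻¹ : Circle)‖ ^ 2 ≤ (1 / 2) ^ 2 := by
      gcongr; exact h5.trans hs
    simp only [hc]
    linarith
  have hsum1 : ∑ i, c i = 0 := by
    simp only [hc]
    rw [← Complex.re_sum, ← Finset.mul_sum, h2]; simp
  have hsum2 : ∑ i, c i ^ 2 = n / 2 := by
    have : ∀ i, c i ^ 2 = 1 / 2 + 1 / 2 * (conj (a : ℂ) ^ 2 * (y i : ℂ) ^ 4).re := by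
      intro i
      set w := conj (a : ℂ) * (y i : ℂ) ^ 2 with hw
      have h1 : Complex.normSq w = 1 := by
        rw [Complex.normSq_eq_norm_sq, hw]; simp [Circle.norm_coe]
      have h3 : conj (a : ℂ) ^ 2 * (y i : ℂ) ^ 4 = w * w := by rw [hw]; ring
      rw [Complex.normSq_apply] at h1
      rw [h3, Complex.mul_re]
      simp only [hc]
      linear_combination (1 / 2) * h1
    rw [Finset.sum_congr rfl fun i _ => this i, Finset.sum_add_distrib, ← Finset.mul_sum,
      ← Complex.re_sum, ← Finset.mul_sum, h4]
    simp; ring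
  -- A nonnegative quadratic majorant of `c`, tangent at `1 / 2`, lets the sum extend from `T` to
  -- all indices. Its total `3k/2` is below the lower bound `7k/4` on `T`.
  have hup : ∑ i ∈ T, c i ≤ ∑ i, (c i + 1 / 2) ^ 2 / 2 := by
    calc ∑ i ∈ T, c i ≤ ∑ i ∈ T, (c i + 1 / 2) ^ 2 / 2 :=
          Finset.sum_le_sum fun i _ => by nlinarith [sq_nonneg (c i - 1 / 2)]
      _ ≤ _ := Finset.sum_le_sum_of_subset_of_nonneg (Finset.subset_univ _)
          fun i _ _ => by positivity
  have htot : ∑ i, (c i + 1 / 2) ^ 2 / 2 = 3 * (n : ℝ) / 8 := by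
    have : ∀ i, (c i + 1 / 2) ^ 2 / 2 = 1 / 2 * c i ^ 2 + 1 / 2 * c i + 1 / 8 := fun i => by ring
    rw [Finset.sum_congr rfl fun i _ => this i, Finset.sum_add_distrib, Finset.sum_add_distrib,
      ← Finset.mul_sum, ← Finset.mul_sum, hsum1, hsum2]
    simp; ring
  have hlow : (T.card : ℝ) * (7 / 8) ≤ ∑ i ∈ T, c i := by
    rw [← nsmul_eq_mul]; exact Finset.card_nsmul_le_sum _ _ _ hcT
  have hT' : (2 * k : ℝ) ≤ T.card := by exact_mod_cast hT
  have hn' : (n : ℝ) = 4 * k := by rw [hn]; push_cast; ring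
  have hk' : (2 : ℝ) ≤ k := by exact_mod_cast hk
  rw [htot, hn'] at hup
  linarith

/-- Synchronization of two runs which are both accurate up to an isometry. -/
lemma synchronization_bound {n k : ℕ} (hn : n = 4 * k) (hk : 2 ≤ k) {x y : Fin n → Circle}
    (hy : y ∈ regularPositions (Fin n)) {S S' : Finset (Fin n)} (hS : S.card = k)
    (hS' : S'.card = k) (hSS' : Disjoint S S') {δ Δ : ℝ} (hδ : ∀ i, geoDist (x i) (y i) ≤ δ)
    (hsmall : 4 * Δ + 2 * δ ≤ 1 / 2) {x2 x2' : Fin n → Circle} {Q₁ Q₂ Q : ℂ ≃ₗᵢ[ℝ] ℂ}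
    (h₁ : ∀ i ∉ S, geoDist (x2 i) (act Q₁ (x i)) ≤ Δ)
    (h₂ : ∀ i ∉ S', geoDist (x2' i) (act Q₂ (x i)) ≤ Δ)
    (hQ : IsSynchronizer (Sᶜ ∩ S'ᶜ) x2 x2' Q) (j : Fin n) :
    geoDist (if j ∈ S then act Q (x2' j) else x2 j) (act Q₁ (x j)) ≤ 5 * Δ := by
  set T := Sᶜ ∩ S'ᶜ with hT
  have hTcard : T.card = 2 * k := by
    rw [hT, ← Finset.compl_union, Finset.card_compl, Finset.card_union_of_disjoint hSS',
      Fintype.card_fin]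
    omega
  have hTmem : ∀ i ∈ T, i ∉ S ∧ i ∉ S' := fun i hi => by simpa [hT] using hi
  obtain ⟨i₀, hi₀⟩ : T.Nonempty := by rw [← Finset.card_pos]; omega
  have hΔ : 0 ≤ Δ := (geoDist_nonneg _ _).trans (h₁ i₀ (hTmem i₀ hi₀).1)
  have hsync : ∀ i ∈ T, geoDist (x2 i) (act Q (x2' i)) ≤ 2 * Δ := by
    intro i hi
    refine (geoDist_le_dInf (fun i : T => x2 i) (fun i : T => act Q (x2' i)) ⟨i, hi⟩).trans
      -- The competitor `Q₁ ∘ Q₂⁻¹` already synchronizes up to `2Δ`.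
      ((hQ (Q₂.symm.trans Q₁)).trans (dInf_le (by positivity) fun l => ?_))
    have h3 := geoDist_triangle (x2 l) (act Q₁ (x l)) (act (Q₂.symm.trans Q₁) (x2' l))
    have h4 : geoDist (act Q₁ (x l)) (act (Q₂.symm.trans Q₁) (x2' l)) =
        geoDist (x2' l) (act Q₂ (x l)) := by
      rw [act_trans, geoDist_act, ← geoDist_act Q₂, act_act_symm, geoDist_comm]
    have h5 := h₁ l (hTmem l l.2).1
    have h6 := h₂ l (hTmem l l.2).2
    linarith
  -- The synchronization error as an isometry. A rotation moves all points equally, so control on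
  -- `T` extends to every index; a reflection is ruled out.
  set R := (Q₂.trans Q).trans Q₁.symm with hR
  have hRx : ∀ i, geoDist (x i) (act R (x i)) = geoDist (act Q₁ (x i)) (act Q (act Q₂ (x i))) := by
    intro i
    rw [← geoDist_act Q₁ (x i), hR]; simp
  have hRT : ∀ i ∈ T, geoDist (x i) (act R (x i)) ≤ 4 * Δ := by
    intro i hi
    rw [hRx]
    have h3 := geoDist_triangle (act Q₁ (x i)) (x2 i) (act Q (act Q₂ (x i)))
    have h4 := geoDist_triangle (x2 i) (act Q (x2' i)) (act Q (act Q₂ (x i)))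
    rw [geoDist_act] at h4
    rw [geoDist_comm _ (x2 i)] at h3
    linarith [h₁ i (hTmem i hi).1, h₂ i (hTmem i hi).2, hsync i hi]
  have hRall : ∀ i, geoDist (x i) (act R (x i)) ≤ 4 * Δ := by
    obtain ⟨a, ha | ha⟩ := act_eq_rotation_or_reflection R
    · intro i
      have h3 : ∀ l, geoDist (x l) (act R (x l)) = geoDist 1 a := fun l => by
        rw [ha, mul_comm, ← geoDist_mul_left (x l) 1 a, mul_one]
      rw [h3, ← h3 i₀]
      exact hRT i₀ hi₀
    · refine (not_reflection hn hk hy hTcard.ge a hsmall fun i hi => ?_).elim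
      refine (norm_sub_le_geoDist _ _).trans ?_
      rw [← ha]
      have h3 := geoDist_triangle (y i) (x i) (act R (y i))
      have h4 := geoDist_triangle (x i) (act R (x i)) (act R (y i))
      rw [geoDist_act] at h4
      rw [geoDist_comm (y i) (x i)] at h3
      linarith [hRT i hi, hδ i]
  split_ifs with hj
  · have hj' : j ∉ S' := fun h => Finset.disjoint_left.1 hSS' hj h
    have h3 := geoDist_triangle (act Q (x2' j)) (act Q (act Q₂ (x j))) (act Q₁ (x j))
    rw [geoDist_act, geoDist_comm (act Q (act Q₂ (x j))), ← hRx] at h3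
    linarith [h₂ j hj', hRall j]
  · linarith [h₁ j hj]

/-! ### Rounding an isometry to a symmetry of the grid -/

/-- An isometry is an orientation and an angle; rounding the angle to the nearest root of unity
moves all points by the same small amount. A general isometry could increase the distance to regular
positions, a grid symmetry does not. -/
lemma exists_symmetry_near {n : ℕ} (hn : n ≠ 0) (Q : ℂ ≃ₗᵢ[ℝ] ℂ) :
    ∃ R : ℂ ≃ₗᵢ[ℝ] ℂ, (∀ x, geoDist (act Q x) (act R x) ≤ Real.pi / n) ∧
      ∀ y ∈ regularPositions (Fin n), (fun i => act R (y i)) ∈ regularPositions (Fin n) := by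
  have hcard : Fintype.card (Fin n) ≠ 0 := by simpa using hn
  obtain ⟨a, ha | ha⟩ := act_eq_rotation_or_reflection Q <;>
    obtain ⟨w, hw, hwa⟩ := exists_grid_near hn a
  · refine ⟨rotation w, fun x => ?_, fun y hy => ?_⟩
    · rwa [ha, act_rotation, mul_comm, mul_comm w, geoDist_mul_left, geoDist_comm]
    · rw [mem_regularPositions_iff hcard] at hy ⊢
      refine ⟨fun i j h => hy.1 (by simpa using h), fun i => ?_⟩
      rw [act_rotation, mul_pow, hy.2 i]
      simpa using hw
  · refine ⟨Complex.conjLIE.trans (rotation w), fun x => ?_, fun y hy => ?_⟩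
    · rwa [ha, act_conj_rotation, mul_comm, mul_comm w, geoDist_mul_left, geoDist_comm]
    · rw [mem_regularPositions_iff hcard] at hy ⊢
      simp only [act_conj_rotation]
      refine ⟨fun i j h => hy.1 (by simpa using h), fun i => ?_⟩
      rw [mul_pow, inv_pow, hy.2 i]
      simpa using hw

/-- The representation obtained by applying an isometry of the circle to the positions. -/
noncomputable def actRep {n : ℕ} (R : ℂ ≃ₗᵢ[ℝ] ℂ) (p : (Fin n → Circle) × (Circle → Circle → ℝ)) :
    (Fin n → Circle) × (Circle → Circle → ℝ) :=
  (fun i => act R (p.1 i), fun x y => p.2 (act R.symm x) (act R.symm y))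

lemma actRep_mem_reps {n : ℕ} {cl cL ce : ℝ} {F : Fin n → Fin n → ℝ} (R : ℂ ≃ₗᵢ[ℝ] ℂ)
    {p : (Fin n → Circle) × (Circle → Circle → ℝ)} (hp : p ∈ reps cl cL ce F) :
    actRep R p ∈ reps cl cL ce F := by
  refine ⟨⟨fun x y => hp.1.mem_unit _ _, fun x y => hp.1.symm _ _, fun x y y' => ?_,
    fun x y y' h => ?_⟩, fun i j hij => ?_⟩
  · simpa [actRep] using hp.1.upper (act R.symm x) (act R.symm y) (act R.symm y')
  · simpa [actRep] using hp.1.lower (act R.symm x) (act R.symm y) (act R.symm y') (by simpa using h)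
  · simpa [actRep] using hp.2 i j hij

lemma dReg_act_le {n : ℕ} {R : ℂ ≃ₗᵢ[ℝ] ℂ}
    (hR : ∀ y ∈ regularPositions (Fin n), (fun i => act R (y i)) ∈ regularPositions (Fin n))
    (x : Fin n → Circle) : dReg (fun i => act R (x i)) ≤ dReg x := by
  obtain ⟨y, hy, h⟩ := exists_dInf_eq_dReg x
  rw [← h, ← dInf_act R x y]
  exact dReg_le_dInf _ (hR y hy)

/-- Deterministic error bound of the whole procedure when both runs are good. -/
lemma localizeAndRefine_bound {n k : ℕ} (hn : n = 4 * k) (hk : 3 ≤ k) {cl cL ce : ℝ}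
    (hcl : 0 < cl) (hcL : cl ≤ cL) (hce : 0 ≤ ce) {F : Fin n → Fin n → ℝ}
    {p : (Fin n → Circle) × (Circle → Circle → ℝ)} (hp : p ∈ reps cl cL ce F)
    {e : UpperPair n → ℝ} {S S' : Finset (Fin n)} (hS : S.card = n / 4) (hS' : S'.card = n / 4)
    (hSS' : Disjoint S S') (I I' : InitialEstimator n) {y : Fin n → Circle}
    (hy : y ∈ regularPositions (Fin n))
    (hgood : GoodRun e S (I.toFun S (submatrix (observation F e) S)) y)
    (hgood' : GoodRun e S' (I'.toFun S' (submatrix (observation F e) S')) y)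
    {δ : ℝ} (hδ : dInf p.1 y ≤ δ) (hr : rate n ≤ δ)
    (hsmall : (4 * runConst cl cL ce + 2) * δ ≤ 1 / 2) {xhat : Fin n → Circle}
    (hx : IsLocalizeAndRefine I I' (observation F e) S S' xhat) :
    ∃ R : ℂ ≃ₗᵢ[ℝ] ℂ, dReg (actRep R p).1 ≤ dReg p.1 ∧
      dInf xhat (actRep R p).1 ≤ (5 * runConst cl cL ce + 4) * δ := by
  obtain ⟨x2, x2', Q, hx2, hx2', hQ, hxhat⟩ := hx
  have hδ' : ∀ i, geoDist (p.1 i) (y i) ≤ δ := fun i => (geoDist_le_dInf _ _ i).trans hδ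
  obtain ⟨Q₁, h₁⟩ := hgood.exists_isometry hn hk hcl hcL hce hp hS I hδ' hr hx2
  obtain ⟨Q₂, h₂⟩ := hgood'.exists_isometry hn hk hcl hcL hce hp hS' I' hδ' hr hx2'
  obtain ⟨R, hR, hRreg⟩ := exists_symmetry_near (n := n) (by omega) Q₁
  have hK := runConst_pos hcl hcL hce
  have hδ0 : 0 ≤ δ := (rate_nonneg n).trans hr
  refine ⟨R, dReg_act_le hRreg _, dInf_le (by positivity) fun j => ?_⟩
  have h3 := synchronization_bound hn (by omega) hy (by omega) (by omega) hSS' hδ'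
    (by linarith) h₁ h₂ hQ j
  rw [← hxhat] at h3
  have h4 := geoDist_triangle (xhat j) (act Q₁ (p.1 j)) (act R (p.1 j))
  have h5 : Real.pi / n ≤ 4 * δ := by
    have hn0 : (0 : ℝ) < n := by positivity [(by omega : 0 < n)]
    rw [div_le_iff₀ hn0]
    have h6 := one_le_mul_rate (n := n) (by omega)
    have h7 : (n : ℝ) * rate n ≤ n * δ := by gcongr
    linarith [Real.pi_le_four]
  have h6 := hR (p.1 j)
  change geoDist (xhat j) (act R (p.1 j)) ≤ _
  linarith

/-! ### Concentration of the trace of a uniform random subset -/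

lemma card_filter_superset_le {α : Type*} [Fintype α] [DecidableEq α] (k : ℕ) (R : Finset α) :
    (((Finset.powersetCard k Finset.univ).filter fun s => R ⊆ s).card) ≤
      (Fintype.card α - R.card).choose (k - R.card) := by
  rw [← Finset.card_compl, ← Finset.card_powersetCard]
  refine Finset.card_le_card_of_injOn (fun s => s \ R) (fun s hs => ?_) fun s hs t ht hst => ?_
  · simp only [Finset.coe_filter, Finset.mem_powersetCard, Set.mem_ofPred_eq] at hs
    simp only [Finset.mem_coe, Finset.mem_powersetCard]
    refine ⟨fun x hx => ?_, ?_⟩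
    · simp only [Finset.mem_sdiff] at hx; simpa using hx.2
    · rw [Finset.card_sdiff_of_subset hs.2, hs.1.2]
  · simp only [Finset.coe_filter, Set.mem_ofPred_eq] at hs ht
    rw [← Finset.sdiff_union_of_subset hs.2, ← Finset.sdiff_union_of_subset ht.2]
    exact congrArg (· ∪ R) hst

/-- A uniform `k`-subset contains a given `r`-set with probability at most `(k/N)^r`, because each
factor `(k-j)/(N-j)` is at most `k/N`. -/
lemma choose_sub_mul_pow_le {N k : ℕ} (hk : k ≤ N) :
    ∀ r ≤ k, (N - r).choose (k - r) * N ^ r ≤ N.choose k * k ^ r := by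
  intro r
  induction r with
  | zero => simp
  | succ r ih =>
    intro hr
    have ih' := ih (by omega)
    obtain ⟨a, rfl⟩ : ∃ a, k = r + 1 + a := ⟨k - (r + 1), by omega⟩
    obtain ⟨b, rfl⟩ : ∃ b, N = r + 1 + a + b := ⟨N - (r + 1 + a), by omega⟩
    have e1 : r + 1 + a + b - (r + 1) = a + b := by omega
    have e2 : r + 1 + a - (r + 1) = a := by omega
    have e3 : r + 1 + a + b - r = a + b + 1 := by omega
    have e4 : r + 1 + a - r = a + 1 := by omega
    rw [e3, e4] at ih'
    rw [e1, e2]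
    have h1 := Nat.add_one_mul_choose_eq (a + b) a
    have h2 : (a + 1) * (r + 1 + a + b) ≤ (r + 1 + a) * (a + b + 1) := by nlinarith
    refine Nat.le_of_mul_le_mul_left ?_ (by omega : 0 < a + b + 1)
    calc (a + b + 1) * ((a + b).choose a * (r + 1 + a + b) ^ (r + 1))
        = ((a + b + 1) * (a + b).choose a) * (r + 1 + a + b) ^ r * (r + 1 + a + b) := by ring
      _ = ((a + b + 1).choose (a + 1) * (r + 1 + a + b) ^ r) *
          ((a + 1) * (r + 1 + a + b)) := by rw [h1]; ring
      _ ≤ ((r + 1 + a + b).choose (r + 1 + a) * (r + 1 + a) ^ r) *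
          ((r + 1 + a) * (a + b + 1)) := Nat.mul_le_mul ih' h2
      _ = _ := by ring

/-- Exponential moments of the hypergeometric distribution are at most those of the binomial. -/
lemma sum_pow_card_inter_le {α : Type*} [Fintype α] [DecidableEq α] {k : ℕ}
    (hk : k ≤ Fintype.card α) (hα : 0 < Fintype.card α) (M : Finset α) {a : ℝ} (ha : 0 ≤ a) :
    ∑ s ∈ Finset.powersetCard k Finset.univ, (1 + a) ^ (s ∩ M).card ≤
      (Fintype.card α).choose k * (1 + a * (k / Fintype.card α)) ^ M.card := by
  set N := Fintype.card α
  have hN : (0 : ℝ) < N := by exact_mod_cast hα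
  have hpow : ∀ (X : Finset α) (b : ℝ), (1 + b) ^ X.card = ∑ R ∈ X.powerset, b ^ R.card := by
    intro X b
    rw [add_comm, ← Finset.sum_pow_mul_eq_add_pow]; simp
  -- Binomial expansion over the subsets of `s ∩ M`; exchanging sums leaves only inclusion
  -- probabilities.
  have h1 : ∀ s : Finset α, (1 + a) ^ (s ∩ M).card =
      ∑ R ∈ M.powerset, if R ⊆ s then a ^ R.card else 0 := by
    intro s
    rw [hpow, ← Finset.sum_filter]
    refine Finset.sum_congr ?_ fun _ _ => rfl
    ext R
    rw [Finset.mem_powerset, Finset.subset_inter_iff, Finset.mem_filter, Finset.mem_powerset,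
      and_comm]
  rw [Finset.sum_congr rfl fun s _ => h1 s, Finset.sum_comm, hpow, Finset.mul_sum]
  refine Finset.sum_le_sum fun R _ => ?_
  rw [← Finset.sum_filter, Finset.sum_const, nsmul_eq_mul, mul_pow]
  have h2 : ((((Finset.powersetCard k Finset.univ).filter fun s => R ⊆ s).card : ℕ) : ℝ) ≤
      N.choose k * (k / N : ℝ) ^ R.card := by
    rcases le_or_gt R.card k with hR | hR
    · have h3 := card_filter_superset_le k R
      have h4 := choose_sub_mul_pow_le hk R.card hR
      rw [div_pow, ← mul_div_assoc, le_div_iff₀ (by positivity)]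
      have h5 := (Nat.mul_le_mul_right (N ^ R.card) h3).trans h4
      exact_mod_cast h5
    · have : ((Finset.powersetCard k Finset.univ).filter fun s => R ⊆ s) = ∅ := by
        rw [Finset.filter_eq_empty_iff]
        intro s hs hRs
        have := Finset.card_le_card hRs
        rw [(Finset.mem_powersetCard.1 hs).2] at this
        omega
      rw [this, Finset.card_empty, Nat.cast_zero]; positivity
  calc _ ≤ (N.choose k * (k / N : ℝ) ^ R.card) * a ^ R.card := by gcongr
    _ = _ := by ring

/-- Upper tail of the trace on `M` of a uniform subset containing a quarter of all points. -/
lemma card_filter_inter_ge_le {n k : ℕ} (hn : n = 4 * k) (hk : 0 < k) (M : Finset (Fin n)) {t : ℝ}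
    (ht0 : 0 ≤ t) (ht : t ≤ n / 2) :
    ((((Finset.powersetCard k Finset.univ).filter fun s : Finset (Fin n) =>
      (M.card : ℝ) / 4 + t ≤ (s ∩ M).card).card : ℕ) : ℝ) ≤
      n.choose k * Real.exp (-t ^ 2 / n) := by
  have hn0 : (0 : ℝ) < n := by rw [hn]; positivity
  have hk0 : (0 : ℝ) < k := by positivity
  -- Minimizes the Chernoff exponent `n λ² / 4 - λ t`. The bound `t ≤ n / 2` gives `λ ≤ 1`, needed
  -- for `exp λ - 1 ≤ λ + λ²`.
  set lam : ℝ := 2 * t / n with hlam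
  have hlam0 : 0 ≤ lam := by positivity
  have hlam1 : lam ≤ 1 := by rw [hlam, div_le_one hn0]; linarith
  have hexp : Real.exp lam - 1 ≤ lam + lam ^ 2 := by
    have := Real.abs_exp_sub_one_sub_id_le (x := lam) (by rwa [abs_of_nonneg hlam0])
    linarith [(abs_le.1 this).2]
  have h1 := sum_pow_card_inter_le (k := k) (by simp; omega) (by simp; omega) M
    (a := Real.exp lam - 1) (by linarith [Real.add_one_le_exp lam])
  rw [Fintype.card_fin] at h1
  have hkn : (k / n : ℝ) = 1 / 4 := by rw [hn]; push_cast; field_simp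
  rw [hkn] at h1
  set bad := (Finset.powersetCard k Finset.univ).filter fun s : Finset (Fin n) =>
      (M.card : ℝ) / 4 + t ≤ (s ∩ M).card
  have h2 : (bad.card : ℝ) * Real.exp (lam * (M.card / 4 + t)) ≤
      ∑ s ∈ Finset.powersetCard k Finset.univ, (1 + (Real.exp lam - 1)) ^ (s ∩ M).card := by
    rw [← nsmul_eq_mul]
    refine (Finset.card_nsmul_le_sum bad
      (fun s => (1 + (Real.exp lam - 1)) ^ (s ∩ M).card) _ fun s hs => ?_).trans ?_
    · rw [add_sub_cancel, ← Real.exp_nat_mul, Real.exp_le_exp, mul_comm]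
      gcongr
      exact (Finset.mem_filter.1 hs).2
    · refine Finset.sum_le_sum_of_subset_of_nonneg (Finset.filter_subset _ _) fun s _ _ => ?_
      rw [add_sub_cancel]; positivity
  have hM : (M.card : ℝ) ≤ n := by
    have := M.card_le_univ; rw [Fintype.card_fin] at this; exact_mod_cast this
  have h3 : (1 + (Real.exp lam - 1) * (1 / 4)) ^ M.card ≤
      Real.exp (lam * (M.card / 4) + n * lam ^ 2 / 4) := by
    calc (1 + (Real.exp lam - 1) * (1 / 4)) ^ M.card
        ≤ Real.exp ((lam + lam ^ 2) * (1 / 4)) ^ M.card := by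
          gcongr
          · linarith [Real.exp_pos lam]
          · have := Real.add_one_le_exp ((lam + lam ^ 2) * (1 / 4)); linarith
      _ = Real.exp (M.card * ((lam + lam ^ 2) * (1 / 4))) := by rw [← Real.exp_nat_mul]
      _ ≤ _ := by rw [Real.exp_le_exp]; nlinarith [sq_nonneg lam]
  have h4 : (bad.card : ℝ) * Real.exp (lam * (M.card / 4 + t)) ≤
      n.choose k * Real.exp (lam * (M.card / 4) + n * lam ^ 2 / 4) :=
    h2.trans (h1.trans (by gcongr))
  have h5 : lam * (M.card / 4) + n * lam ^ 2 / 4 = -t ^ 2 / n + lam * (M.card / 4 + t) := by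
    rw [hlam]; field_simp; ring
  rw [h5, Real.exp_add, ← mul_assoc] at h4
  exact le_of_mul_le_mul_right h4 (Real.exp_pos _)

/-- If `S` contains a fair share of every initial segment of the grid, then the points of `S` are
close to regular positions. -/
lemma exists_regular_of_balanced {n k : ℕ} (hn : n = 4 * k) {S : Finset (Fin n)} (hS : S.card = k)
    {y : Fin n → Circle} (σ : Fin n ≃ Fin (Fintype.card (Fin n)))
    (hσ : ∀ i, y i = gridPoint (Fintype.card (Fin n)) (σ i)) {t : ℝ}
    (hbal : ∀ l < n, |((S ∩ Finset.univ.filter fun i => (σ i : ℕ) < l).card : ℝ) - l / 4| ≤ t) :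
    ∃ v ∈ regularPositions S, ∀ j : S, geoDist (y j) (v j) ≤ 2 * Real.pi / k * t := by
  classical
  -- The rank of `j` within `S`, counted from zero. Balance says that rank and `σ j / 4` nearly
  -- agree, so the grid point of that rank is close to `y j`.
  set m : Fin n → ℕ := fun j => (S ∩ Finset.univ.filter fun i => (σ i : ℕ) < σ j).card with hm
  have hmono : ∀ i j : S, (σ i : ℕ) < σ j → m i < m j := by
    intro i j hij
    refine Finset.card_lt_card ((Finset.ssubset_iff_of_subset fun l hl => ?_).2 ⟨i, ?_, ?_⟩)
    · simp only [Finset.mem_inter, Finset.mem_filter, Finset.mem_univ, true_and] at hl ⊢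
      exact ⟨hl.1, hl.2.trans hij⟩
    · simpa using hij
    · simp
  have hlt : ∀ j : S, m j < Fintype.card S := by
    intro j
    rw [Fintype.card_coe]
    refine Finset.card_lt_card ((Finset.ssubset_iff_of_subset Finset.inter_subset_left).2
      ⟨j, j.2, ?_⟩)
    simp
  have hbij : Function.Bijective (fun j : S => (⟨m j, hlt j⟩ : Fin (Fintype.card S))) := by
    rw [Fintype.bijective_iff_injective_and_card]
    refine ⟨fun i j h => ?_, by simp⟩
    have h' : m i = m j := congrArg Fin.val h
    rcases lt_trichotomy (σ i : ℕ) (σ j) with h1 | h1 | h1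
    · have := hmono i j h1; omega
    · exact Subtype.ext (σ.injective (Fin.ext h1))
    · have := hmono j i h1; omega
  refine ⟨fun j => gridPoint (Fintype.card S) (m j), ⟨Equiv.ofBijective _ hbij, fun j => rfl⟩,
    fun j => ?_⟩
  have hk : (0 : ℝ) < k := by
    have : 0 < S.card := Finset.card_pos.2 ⟨j, j.2⟩
    rw [hS] at this; exact_mod_cast this
  have hnk : (n : ℝ) = 4 * k := by rw [hn]; push_cast; ring
  have hl : (σ (j : Fin n) : ℕ) < n := (σ (j : Fin n)).2.trans_eq (Fintype.card_fin n)
  have hcn : (Fintype.card (Fin n) : ℝ) = 4 * k := by rw [← hnk]; simp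
  rw [hσ]
  unfold gridPoint
  refine (geoDist_exp_le _ _).trans ?_
  rw [hcn, Fintype.card_coe, hS]
  have h2 : 2 * Real.pi * (σ (j : Fin n) : ℕ) / (4 * k) - 2 * Real.pi * (m j : ℕ) / k =
      -(2 * Real.pi / k) * ((m j : ℝ) - (σ (j : Fin n) : ℕ) / 4) := by
    field_simp; ring
  rw [h2, abs_mul, abs_neg, abs_of_nonneg (by positivity)]
  gcongr
  exact hbal _ hl

lemma exp_neg_mul_log {n : ℕ} (hn : 0 < n) (c : ℕ) :
    Real.exp (-(c * Real.log n)) = 1 / (n : ℝ) ^ c := by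
  rw [Real.exp_neg, Real.exp_nat_mul, Real.exp_log (by positivity), one_div]

/-- A uniform subset of a quarter of the indices is evenly spread, with high probability. -/
lemma measureReal_not_spread_le {Ω : Type*} [MeasurableSpace Ω] {P : Measure Ω}
    [IsProbabilityMeasure P] {n k : ℕ} (hn : n = 4 * k) (hk : 0 < k) (hr : rate n ≤ 1 / 6)
    {S : Ω → Finset (Fin n)}
    (hS : ∀ s : Finset (Fin n), s.card = n / 4 →
      P.real {ω | S ω = s} = 1 / (n.choose (n / 4) : ℝ))
    {y : Fin n → Circle} (hy : y ∈ regularPositions (Fin n)) :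
    P.real {ω | (S ω).card = n / 4 ∧ ¬ ∃ v ∈ regularPositions (S ω), ∀ j : S ω,
      geoDist (y j) (v j) ≤ 96 * rate n} ≤ 1 / (n : ℝ) ^ 3 := by
  classical
  obtain ⟨σ, hσ⟩ := hy
  have hnk : n / 4 = k := by omega
  have hn0 : (0 : ℝ) < n := by rw [hn]; positivity
  have hk0 : (0 : ℝ) < k := by positivity
  have hnk' : (n : ℝ) = 4 * k := by rw [hn]; push_cast; ring
  rw [hnk] at hS ⊢
  have hr0 := rate_nonneg n
  -- Each tail is then `n⁻⁹`, which absorbs the union over `2n` events; `rate n ≤ 1 / 6` ensures `t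
  -- ≤ n / 2`.
  set t : ℝ := 3 * n * rate n with ht
  have ht0 : 0 ≤ t := by positivity
  set M : ℕ → Finset (Fin n) := fun l => Finset.univ.filter fun i => (σ i : ℕ) < l with hM
  have hMcard : ∀ l ≤ n, (M l).card = l := by
    intro l hl
    have : (M l).map σ.toEmbedding =
        (Finset.univ.filter fun i : Fin (Fintype.card (Fin n)) => (i : ℕ) < l) := by
      ext i
      simp only [hM, Finset.mem_map_equiv, Finset.mem_filter, Finset.mem_univ, true_and,
        Equiv.apply_symm_apply]
    rw [← Finset.card_map σ.toEmbedding, this, Fin.card_filter_val_lt]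
    simpa using hl
  set up : Finset (Fin n) → Finset (Finset (Fin n)) := fun X =>
    (Finset.powersetCard k Finset.univ).filter fun s : Finset (Fin n) =>
      (X.card : ℝ) / 4 + t ≤ (s ∩ X).card with hup
  -- An upper tail on the complement of a segment is a lower tail on the segment, since the two
  -- counts add up to `k`.
  set bad : Finset (Finset (Fin n)) :=
    (Finset.range n).biUnion fun l => up (M l) ∪ up (M l)ᶜ with hbad
  have hbadcard : (bad.card : ℝ) ≤ n.choose k * (1 / (n : ℝ) ^ 3) := by
    have h1 : ∀ X : Finset (Fin n), ((up X).card : ℝ) ≤ n.choose k * (1 / (n : ℝ) ^ 9) := by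
      intro X
      refine (card_filter_inter_ge_le hn hk X ht0 (by rw [ht]; nlinarith)).trans ?_
      have h2 : -t ^ 2 / n = -((9 : ℕ) * Real.log n) := by
        rw [← mul_rate_sq (by omega : 0 < n), ht]; field_simp; ring
      rw [h2, exp_neg_mul_log (by omega)]
    have h2 : (bad.card : ℝ) ≤ ∑ _l ∈ Finset.range n, 2 * (n.choose k * (1 / (n : ℝ) ^ 9)) := by
      refine le_trans (Nat.cast_le.2 Finset.card_biUnion_le) ?_
      rw [Nat.cast_sum]
      refine Finset.sum_le_sum fun l _ => ?_
      have h3 : ((up (M l) ∪ up (M l)ᶜ).card : ℝ) ≤ (up (M l)).card + (up (M l)ᶜ).card := by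
        exact_mod_cast Finset.card_union_le _ _
      linarith [h1 (M l), h1 (M l)ᶜ]
    refine h2.trans ?_
    rw [Finset.sum_const, Finset.card_range, nsmul_eq_mul]
    have h4 : (4 : ℝ) ≤ n := by
      have : (1 : ℝ) ≤ k := by exact_mod_cast hk
      linarith
    have h5 : (n : ℝ) * (2 * (1 / (n : ℝ) ^ 9)) ≤ 1 / (n : ℝ) ^ 3 := by
      rw [mul_one_div, mul_div_assoc', div_le_div_iff₀ (by positivity) (by positivity)]
      have : (n : ℝ) * 2 * n ^ 3 ≤ n * n * n ^ 3 := by gcongr; linarith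
      calc _ = (n : ℝ) * 2 * n ^ 3 := by ring
        _ ≤ n ^ 5 * 1 ^ 4 := by linarith
        _ ≤ n ^ 5 * n ^ 4 := by gcongr; linarith
        _ = _ := by ring
    calc _ = (n.choose k : ℝ) * (n * (2 * (1 / (n : ℝ) ^ 9))) := by ring
      _ ≤ _ := by gcongr
  have hsub : {ω | (S ω).card = k ∧ ¬ ∃ v ∈ regularPositions (S ω), ∀ j : S ω,
      geoDist (y j) (v j) ≤ 96 * rate n} ⊆ ⋃ s ∈ bad, {ω | S ω = s} := by
    rintro ω ⟨hc, hno⟩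
    simp only [Set.mem_iUnion, Set.mem_ofPred_eq, exists_prop, exists_eq_right']
    by_contra hb
    apply hno
    have hbal : ∀ l < n, |((S ω ∩ M l).card : ℝ) - l / 4| ≤ t := by
      intro l hl
      have h1 : S ω ∉ up (M l) ∧ S ω ∉ up (M l)ᶜ := by
        constructor <;> intro h <;> apply hb <;> rw [hbad, Finset.mem_biUnion] <;>
          exact ⟨l, Finset.mem_range.2 hl, by simp [h]⟩
      simp only [hup, Finset.mem_filter, Finset.mem_powersetCard, Finset.subset_univ, hc, true_and,
        not_le, Finset.card_compl, Fintype.card_fin, hMcard l hl.le] at h1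
      have h2 : (S ω ∩ M l).card + (S ω ∩ (M l)ᶜ).card = k := by
        rw [← hc, ← Finset.sdiff_eq_inter_compl, Finset.card_inter_add_card_sdiff]
      have h3 : ((S ω ∩ M l).card : ℝ) + (S ω ∩ (M l)ᶜ).card = k := by exact_mod_cast h2
      rw [Nat.cast_sub hl.le] at h1
      rw [abs_le]
      constructor <;> linarith [h1.1, h1.2]
    obtain ⟨v, hv, h⟩ := exists_regular_of_balanced hn hc σ hσ hbal
    refine ⟨v, hv, fun j => (h j).trans ?_⟩
    have : 2 * Real.pi / k * t = 24 * Real.pi * rate n := by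
      rw [ht, hnk']; field_simp; ring
    rw [this]
    nlinarith [Real.pi_le_four]
  have hchoose : (0 : ℝ) < n.choose k := by
    exact_mod_cast Nat.choose_pos (by omega)
  calc _ ≤ P.real (⋃ s ∈ bad, {ω | S ω = s}) := measureReal_mono hsub (measure_ne_top _ _)
    _ ≤ ∑ s ∈ bad, P.real {ω | S ω = s} := measureReal_biUnion_finset_le _ _
    _ = ∑ s ∈ bad, 1 / (n.choose k : ℝ) := by
      refine Finset.sum_congr rfl fun s hs => hS s ?_
      simp only [hbad, hup, Finset.mem_biUnion, Finset.mem_union, Finset.mem_filter,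
        Finset.mem_powersetCard] at hs
      obtain ⟨l, -, h | h⟩ := hs <;> exact h.1.2
    _ = bad.card / (n.choose k : ℝ) := by rw [Finset.sum_const, nsmul_eq_mul, mul_one_div]
    _ ≤ _ := by rw [div_le_iff₀ hchoose]; linarith

/-! ### Tail bounds for the noise -/

lemma noiseMatrix_of_lt {n : ℕ} (e : UpperPair n → ℝ) {i j : Fin n} (h : i < j) :
    noiseMatrix e i j = e ⟨(i, j), h⟩ := by
  simp [noiseMatrix, observation, h]

lemma noiseMatrix_of_gt {n : ℕ} (e : UpperPair n → ℝ) {i j : Fin n} (h : j < i) :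
    noiseMatrix e i j = e ⟨(j, i), h⟩ := by
  simp [noiseMatrix, observation, h, h.not_gt]

lemma noiseMatrix_self {n : ℕ} (e : UpperPair n → ℝ) (i : Fin n) : noiseMatrix e i i = 0 := by
  simp [noiseMatrix, observation]

lemma sum_upperPair {n : ℕ} (g : Fin n → Fin n → ℝ) :
    ∑ p : UpperPair n, (g p.1.1 p.1.2 + g p.1.2 p.1.1) =
      ∑ i, ∑ j, if i = j then 0 else g i j := by
  have h1 : ∀ h : Fin n → Fin n → ℝ, ∑ p : UpperPair n, h p.1.1 p.1.2 =
      ∑ i, ∑ j, if i < j then h i j else 0 := by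
    intro h
    rw [← Fintype.sum_prod_type' (f := fun i j => if i < j then h i j else 0),
      ← Finset.sum_filter]
    exact (Finset.sum_subtype _ (by simp) fun p : Fin n × Fin n => h p.1 p.2).symm
  rw [Finset.sum_add_distrib, h1, h1 fun i j => g j i]
  rw [Finset.sum_comm (f := fun i j => if i < j then g j i else 0), ← Finset.sum_add_distrib]
  refine Finset.sum_congr rfl fun i _ => ?_
  rw [← Finset.sum_add_distrib]
  refine Finset.sum_congr rfl fun j _ => ?_
  rcases lt_trichotomy i j with h | h | h
  · simp [h, h.not_gt, h.ne]
  · simp [h]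
  · simp [h, h.not_gt, h.ne']

section Tail

variable {Ω : Type*} [MeasurableSpace Ω] {P : Measure Ω} {n : ℕ} {E : UpperPair n → Ω → ℝ}

lemma measureReal_inter_preimage_eq {α β : Type*} [MeasurableSpace α] [MeasurableSpace β]
    {X : Ω → α} {Y : Ω → β} (h : IndepFun X Y P) {A : Set α} {B : Set β} (hA : MeasurableSet A)
    (hB : MeasurableSet B) : P.real (X ⁻¹' A ∩ Y ⁻¹' B) = P.real (X ⁻¹' A) * P.real (Y ⁻¹' B) := by
  simp only [measureReal_def]
  rw [h.measure_inter_preimage_eq_mul A B hA hB, ENNReal.toReal_mul]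

/-- The noise entries outside `Q` replaced by zero. -/
noncomputable def maskNoise (Q : Set (UpperPair n)) (e : UpperPair n → ℝ) : UpperPair n → ℝ :=
  Q.indicator e

/-- The masked vectors are functions of disjoint families of independent entries. Extension by zero
keeps both in the space of full noise vectors, so events need not be rewritten on subfamilies. -/
lemma indepFun_maskNoise (hE : IsSubGaussianNoise P E) (Q : Set (UpperPair n)) :
    IndepFun (fun ω => maskNoise Q fun p => E p ω) (fun ω => maskNoise Qᶜ fun p => E p ω) P := by
  classical
  have key : ∀ R : Finset (UpperPair n), Measurable fun (g : R → ℝ) (p : UpperPair n) =>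
      if hp : p ∈ R then g ⟨p, hp⟩ else 0 := by
    intro R
    refine measurable_pi_lambda _ fun p => ?_
    split_ifs
    · exact measurable_pi_apply _
    · exact measurable_const
  have h2 := (hE.indep.indepFun_finset Q.toFinset Q.toFinsetᶜ disjoint_compl_right
    hE.meas).comp (key _) (key _)
  convert h2 using 2 <;> ext p <;> simp [maskNoise, Set.indicator]

variable [IsProbabilityMeasure P]

/-- Each entry above the diagonal occurs twice, with coefficient `G i j + G j i`. The squared norm
at most doubles, whence `4` instead of `2` in the exponent. -/
lemma noise_tail (hE : IsSubGaussianNoise P E) (G : Fin n → Fin n → ℝ) {t : ℝ} (ht : 0 ≤ t) :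
    P.real {ω | t * √(∑ i, ∑ j, G i j ^ 2) <
      ∑ i, ∑ j, noiseMatrix (fun p => E p ω) i j * G i j} ≤ Real.exp (-t ^ 2 / 4) := by
  set B : UpperPair n → ℝ := fun p => G p.1.1 p.1.2 + G p.1.2 p.1.1 with hB
  have hlin : ∀ ω, ∑ i, ∑ j, noiseMatrix (fun p => E p ω) i j * G i j = ∑ p, B p * E p ω := by
    intro ω
    have h := sum_upperPair fun i j => noiseMatrix (fun p => E p ω) i j * G i j
    have h2 : ∀ i j, (if i = j then 0 else noiseMatrix (fun p => E p ω) i j * G i j) =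
        noiseMatrix (fun p => E p ω) i j * G i j := by
      intro i j
      split_ifs with hij
      · rw [hij, noiseMatrix_self, zero_mul]
      · rfl
    simp only [h2] at h
    rw [← h]
    refine Finset.sum_congr rfl fun p _ => ?_
    rw [noiseMatrix_of_lt _ p.2, noiseMatrix_of_gt _ p.2, hB]
    ring
  have hsq : ∑ p, B p ^ 2 ≤ 2 * ∑ i, ∑ j, G i j ^ 2 := by
    calc ∑ p, B p ^ 2 ≤ ∑ p : UpperPair n, (2 * G p.1.1 p.1.2 ^ 2 + 2 * G p.1.2 p.1.1 ^ 2) :=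
          Finset.sum_le_sum fun p _ => by
            simp only [hB]; nlinarith [sq_nonneg (G p.1.1 p.1.2 - G p.1.2 p.1.1)]
      _ = ∑ i, ∑ j, if i = j then 0 else 2 * G i j ^ 2 := sum_upperPair fun i j => 2 * G i j ^ 2
      _ ≤ ∑ i, ∑ j, 2 * G i j ^ 2 := by
          refine Finset.sum_le_sum fun i _ => Finset.sum_le_sum fun j _ => ?_
          split_ifs
          · positivity
          · rfl
      _ = _ := by simp only [Finset.mul_sum]
  have h2 : (0 : ℝ) < √2 := by positivity
  have htail := hE.tail B (t / √2) (by positivity)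
  have he : -(t / √2) ^ 2 / 2 = -t ^ 2 / 4 := by
    rw [div_pow, Real.sq_sqrt (by norm_num)]; ring
  rw [he] at htail
  refine le_trans (measureReal_mono (fun ω hω => ?_) (measure_ne_top _ _)) htail
  simp only [Set.mem_ofPred_eq, hlin] at hω ⊢
  refine lt_of_le_of_lt ?_ hω
  rw [div_mul_eq_mul_div, div_le_iff₀ h2, mul_assoc]
  gcongr
  rw [mul_comm, ← Real.sqrt_mul (by norm_num)]
  exact Real.sqrt_le_sqrt hsq

lemma sum_dite_mem {α : Type*} [Fintype α] [DecidableEq α] (S : Finset α) (g : S → ℝ) :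
    ∑ i, (if h : i ∈ S then g ⟨i, h⟩ else 0) = ∑ i : S, g i := by
  rw [← Finset.sum_subset (Finset.subset_univ S) fun i _ hi => by simp [hi],
    ← Finset.sum_coe_sort S]
  simp

lemma noise_tail_subtype (hE : IsSubGaussianNoise P E) (S T : Finset (Fin n)) (G : S → T → ℝ)
    {t : ℝ} (ht : 0 ≤ t) :
    P.real {ω | t * √(∑ i, ∑ j, G i j ^ 2) <
      -∑ i : S, ∑ j : T, noiseMatrix (fun p => E p ω) i j * G i j} ≤ Real.exp (-t ^ 2 / 4) := by
  set G' : Fin n → Fin n → ℝ := fun i j =>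
    if hi : i ∈ S then (if hj : j ∈ T then -G ⟨i, hi⟩ ⟨j, hj⟩ else 0) else 0 with hG'
  have h := noise_tail hE G' ht
  have h1 : ∑ i, ∑ j, G' i j ^ 2 = ∑ i, ∑ j, G i j ^ 2 := by
    rw [← sum_dite_mem S]
    refine Finset.sum_congr rfl fun i _ => ?_
    by_cases hi : i ∈ S
    · simp only [hG', hi, dif_pos]
      rw [← sum_dite_mem T]
      exact Finset.sum_congr rfl fun j _ => by split_ifs <;> simp
    · simp [hG', hi]
  have h2 : ∀ e : UpperPair n → ℝ, ∑ i, ∑ j, noiseMatrix e i j * G' i j =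
      -∑ i : S, ∑ j : T, noiseMatrix e i j * G i j := by
    intro e
    rw [← sum_dite_mem S, ← Finset.sum_neg_distrib]
    refine Finset.sum_congr rfl fun i _ => ?_
    by_cases hi : i ∈ S
    · simp only [hG', hi, dif_pos]
      rw [← sum_dite_mem T, ← Finset.sum_neg_distrib]
      exact Finset.sum_congr rfl fun j _ => by split_ifs <;> simp
    · simp [hG', hi]
  simpa only [h1, h2] using h

/-! ### Exceptional sets of the noise -/

/-- Noise values for which the initial localization on `s` may fail. -/
def badInit (n : ℕ) (s : Finset (Fin n)) : Set (UpperPair n → ℝ) :=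
  {e | ∃ u ∈ regularPositions s, ∃ v ∈ regularPositions s,
    3 * n * rate n * √(∑ i, ∑ j, (geoDist (u i) (u j) - geoDist (v i) (v j)) ^ 2) <
      -∑ i : s, ∑ j : s, noiseMatrix e i j * (geoDist (u i) (u j) - geoDist (v i) (v j))}

/-- Noise values for which the refinement based on the positions `u` on `s` may fail. -/
def badRefined (n : ℕ) (s : Finset (Fin n)) (u : s → Circle) : Set (UpperPair n → ℝ) :=
  {e | ∃ i ∉ s, ∃ z ∈ grid (n / 4), ∃ z' ∈ grid (n / 4),
    8 * √n * rate n * √(∑ j, (geoDist z (u j) - geoDist z' (u j)) ^ 2) <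
      -∑ j : s, noiseMatrix e i j * (geoDist z (u j) - geoDist z' (u j))}

lemma measurable_observation (F : Fin n → Fin n → ℝ) (i j : Fin n) :
    Measurable fun e : UpperPair n → ℝ => observation F e i j := by
  unfold observation
  split_ifs
  · exact (measurable_pi_apply _).const_add _
  · exact (measurable_pi_apply _).const_add _
  · exact measurable_const

lemma measurable_noiseMatrix (i j : Fin n) :
    Measurable fun e : UpperPair n → ℝ => noiseMatrix e i j :=
  measurable_observation _ i j

lemma finite_grid (k : ℕ) : (grid k).Finite := by
  refine ((Set.finite_Iio k).image (gridPoint k)).subset ?_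
  rintro z ⟨j, hj, rfl⟩
  exact ⟨j, hj, rfl⟩

lemma setOf_exists_mem_eq {α β : Type*} (A : Set α) (p : α → β → Prop) :
    {e | ∃ a ∈ A, p a e} = ⋃ a ∈ A, {e | p a e} := by
  ext; simp

lemma measurableSet_badInit (s : Finset (Fin n)) : MeasurableSet (badInit n s) := by
  unfold badInit
  rw [setOf_exists_mem_eq]
  refine (finite_regularPositions s).measurableSet_biUnion fun u _ => ?_
  rw [setOf_exists_mem_eq]
  refine (finite_regularPositions s).measurableSet_biUnion fun v _ => ?_
  exact measurableSet_lt measurable_const (Finset.measurable_sum _ fun i _ =>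
    Finset.measurable_sum _ fun j _ => (measurable_noiseMatrix _ _).mul_const _).neg

lemma measurableSet_badRefined (s : Finset (Fin n)) (u : s → Circle) :
    MeasurableSet (badRefined n s u) := by
  unfold badRefined
  change MeasurableSet {e : UpperPair n → ℝ | ∃ i ∈ {i : Fin n | i ∉ s}, _}
  rw [setOf_exists_mem_eq]
  refine (Set.toFinite _).measurableSet_biUnion fun i _ => ?_
  rw [setOf_exists_mem_eq]
  refine (finite_grid _).measurableSet_biUnion fun z _ => ?_
  rw [setOf_exists_mem_eq]
  refine (finite_grid _).measurableSet_biUnion fun z' _ => ?_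
  exact measurableSet_lt measurable_const (Finset.measurable_sum _ fun j _ =>
    (measurable_noiseMatrix _ _).mul_const _).neg

/-- There are `((n/4)!)² ≤ exp (n log n / 2)` pairs of configurations, each failing with probability
at most `exp (-9 n log n / 4)`. -/
lemma measureReal_badInit_le (hE : IsSubGaussianNoise P E) (hn : 4 ≤ n) {s : Finset (Fin n)}
    (hs : s.card = n / 4) : P.real {ω | (fun p => E p ω) ∈ badInit n s} ≤ 1 / (n : ℝ) ^ 3 := by
  classical
  have hr0 := rate_nonneg n
  set L := Real.log n with hL
  have hL1 : 1 ≤ L := one_le_log hn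
  have hn' : (4 : ℝ) ≤ n := by exact_mod_cast hn
  set pos : (s ≃ Fin (Fintype.card s)) → s → Circle :=
    fun σ i => gridPoint (Fintype.card s) (σ i)
  set t : ℝ := 3 * n * rate n with ht
  have hsub : {ω | (fun p => E p ω) ∈ badInit n s} ⊆
      ⋃ q ∈ (Finset.univ : Finset ((s ≃ Fin (Fintype.card s)) × (s ≃ Fin (Fintype.card s)))),
      {ω | t * √(∑ i, ∑ j, (geoDist (pos q.1 i) (pos q.1 j) -
          geoDist (pos q.2 i) (pos q.2 j)) ^ 2) <
        -∑ i : s, ∑ j : s, noiseMatrix (fun p => E p ω) i j *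
          (geoDist (pos q.1 i) (pos q.1 j) - geoDist (pos q.2 i) (pos q.2 j))} := by
    rintro ω ⟨u, ⟨σ, hσ⟩, v, ⟨τ, hτ⟩, h⟩
    obtain rfl : u = pos σ := funext hσ
    obtain rfl : v = pos τ := funext hτ
    exact Set.mem_biUnion (Finset.mem_coe.2 (Finset.mem_univ (σ, τ))) h
  have hcard : (((Finset.univ : Finset ((s ≃ Fin (Fintype.card s)) ×
      (s ≃ Fin (Fintype.card s)))).card : ℕ) : ℝ) ≤ Real.exp (n / 2 * L) := by
    rw [Finset.card_univ, Fintype.card_prod, Fintype.card_equiv (Fintype.equivFin s),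
      Fintype.card_coe, hs]
    have h1 : (n / 4).factorial ≤ n ^ (n / 4) :=
      (Nat.factorial_le_pow _).trans (Nat.pow_le_pow_left (Nat.div_le_self _ _) _)
    have h2 : (n / 4).factorial * (n / 4).factorial ≤ n ^ (2 * (n / 4)) := by
      rw [two_mul, pow_add]; exact Nat.mul_le_mul h1 h1
    have h3 : ((n : ℝ)) ^ (2 * (n / 4)) ≤ Real.exp (n / 2 * L) := by
      rw [← Real.exp_log (show (0 : ℝ) < n by linarith), ← Real.exp_nat_mul, Real.exp_le_exp,
        Real.exp_log (by linarith)]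
      gcongr
      have : ((n / 4 : ℕ) : ℝ) ≤ n / 4 := by simpa using Nat.cast_div_le (α := ℝ) (m := n) (n := 4)
      push_cast; linarith
    refine le_trans ?_ h3
    exact_mod_cast h2
  have htail : ∀ q ∈ (Finset.univ : Finset ((s ≃ Fin (Fintype.card s)) ×
      (s ≃ Fin (Fintype.card s)))), P.real {ω | t * √(∑ i, ∑ j, (geoDist (pos q.1 i) (pos q.1 j) -
          geoDist (pos q.2 i) (pos q.2 j)) ^ 2) <
        -∑ i : s, ∑ j : s, noiseMatrix (fun p => E p ω) i j *
          (geoDist (pos q.1 i) (pos q.1 j) - geoDist (pos q.2 i) (pos q.2 j))} ≤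
      Real.exp (-t ^ 2 / 4) := fun q _ => noise_tail_subtype hE s s _ (by positivity)
  have ht2 : -t ^ 2 / 4 = -(9 / 4 * n * L) := by
    rw [hL, ← mul_rate_sq (by omega : 0 < n), ht]; ring
  calc _ ≤ _ := measureReal_mono hsub (measure_ne_top _ _)
    _ ≤ _ := measureReal_biUnion_finset_le _ _
    _ ≤ _ := Finset.sum_le_card_nsmul _ _ _ htail
    _ ≤ Real.exp (n / 2 * L) * Real.exp (-t ^ 2 / 4) := by rw [nsmul_eq_mul]; gcongr
    _ ≤ Real.exp (-((3 : ℕ) * L)) := by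
      rw [← Real.exp_add, Real.exp_le_exp, ht2]; push_cast; nlinarith
    _ = _ := exp_neg_mul_log (by omega) 3

/-- For deterministic `u` there are at most `n³` triples of an index and two grid points, each
failing with probability at most `n⁻¹⁶`. -/
lemma measureReal_badRefined_le (hE : IsSubGaussianNoise P E) (hn : 4 ≤ n) (s : Finset (Fin n))
    (u : s → Circle) : P.real {ω | (fun p => E p ω) ∈ badRefined n s u} ≤ 1 / (n : ℝ) ^ 3 := by
  classical
  have hr0 := rate_nonneg n
  set L := Real.log n with hL
  have hn' : (4 : ℝ) ≤ n := by exact_mod_cast hn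
  set t : ℝ := 8 * √n * rate n with ht
  set k := n / 4 with hk
  have hkn : k ≤ n := Nat.div_le_self _ _
  set K : Finset (Fin n × Circle × Circle) :=
    Finset.univ ×ˢ (finite_grid k).toFinset ×ˢ (finite_grid k).toFinset with hK
  set gp : Fin n × Circle × Circle → s → ℝ := fun q j =>
    geoDist q.2.1 (u j) - geoDist q.2.2 (u j) with hgp
  have hsub : {ω | (fun p => E p ω) ∈ badRefined n s u} ⊆
      ⋃ q ∈ K, {ω | t * √(∑ j, gp q j ^ 2) <
        -∑ j : s, noiseMatrix (fun p => E p ω) q.1 j * gp q j} := by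
    rintro ω ⟨i, -, z, hz, z', hz', h⟩
    exact Set.mem_biUnion (x := (i, z, z')) (by simpa [hK] using ⟨hz, hz'⟩) h
  have htail : ∀ q ∈ K, P.real {ω | t * √(∑ j, gp q j ^ 2) <
        -∑ j : s, noiseMatrix (fun p => E p ω) q.1 j * gp q j} ≤ Real.exp (-t ^ 2 / 4) := by
    intro q _
    have := noise_tail_subtype hE {q.1} s (fun _ j => gp q j) (t := t) (by positivity)
    simpa using this
  have ht2 : -t ^ 2 / 4 = -((16 : ℕ) * L) := by
    rw [hL, ← mul_rate_sq (by omega : 0 < n), ht, mul_pow, mul_pow, Real.sq_sqrt (by positivity)]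
    push_cast; ring
  have hgrid : (finite_grid k).toFinset.card ≤ k := by
    calc _ ≤ ((Finset.range k).image (gridPoint k)).card := by
          refine Finset.card_le_card fun z hz => ?_
          obtain ⟨j, hj, rfl⟩ := (finite_grid k).mem_toFinset.1 hz
          exact Finset.mem_image_of_mem _ (Finset.mem_range.2 hj)
      _ ≤ k := Finset.card_image_le.trans_eq (Finset.card_range k)
  have hcard : (K.card : ℝ) ≤ n ^ 3 := by
    have : K.card ≤ n ^ 3 := by
      rw [hK, Finset.card_product, Finset.card_product, Finset.card_univ, Fintype.card_fin]
      calc _ ≤ n * (n * n) := by gcongr <;> omega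
        _ = n ^ 3 := by ring
    exact_mod_cast this
  calc _ ≤ _ := measureReal_mono hsub (measure_ne_top _ _)
    _ ≤ _ := measureReal_biUnion_finset_le _ _
    _ ≤ _ := Finset.sum_le_card_nsmul _ _ _ htail
    _ ≤ (n : ℝ) ^ 3 * Real.exp (-t ^ 2 / 4) := by rw [nsmul_eq_mul]; gcongr
    _ = (n : ℝ) ^ 3 / n ^ 16 := by rw [ht2, exp_neg_mul_log (by omega), mul_one_div]
    _ ≤ _ := by
      rw [div_le_div_iff₀ (by positivity) (by positivity), one_mul, ← pow_add]
      exact pow_le_pow_right₀ (by linarith) (by norm_num)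

/-! ### Decoupling -/

/-- A union bound over a partition, each cell of which is decoupled from its exceptional set. -/
lemma measureReal_iUnion_inter_le {ι : Type*} [Finite ι] (Z B : ι → Set Ω)
    (hZ : ∀ i, MeasurableSet (Z i)) (hd : Pairwise (Function.onFun Disjoint Z)) {q : ℝ}
    (hq : 0 ≤ q) (h : ∀ i, P.real (Z i ∩ B i) ≤ P.real (Z i) * q) :
    P.real (⋃ i, Z i ∩ B i) ≤ q := by
  have := Fintype.ofFinite ι
  calc P.real (⋃ i, Z i ∩ B i) ≤ ∑ i, P.real (Z i ∩ B i) := measureReal_iUnion_fintype_le _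
    _ ≤ ∑ i, P.real (Z i) * q := Finset.sum_le_sum fun i _ => h i
    _ = P.real (⋃ i, Z i) * q := by
      rw [← Finset.sum_mul, measureReal_iUnion_fintype hd hZ]
    _ ≤ 1 * q := by gcongr; exact measureReal_le_one
    _ = q := one_mul q

/-- The pairs of indices which both belong to `s`. -/
def innerPairs (s : Finset (Fin n)) : Set (UpperPair n) := {p | p.1.1 ∈ s ∧ p.1.2 ∈ s}

lemma submatrix_maskNoise (F : Fin n → Fin n → ℝ) (s : Finset (Fin n)) (e : UpperPair n → ℝ) :
    submatrix (observation F (maskNoise (innerPairs s) e)) s = submatrix (observation F e) s := by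
  ext i j
  simp [submatrix, observation, maskNoise, innerPairs, Set.indicator]

lemma noiseMatrix_maskNoise {s : Finset (Fin n)} (e : UpperPair n → ℝ) {i j : Fin n} (hi : i ∉ s) :
    noiseMatrix (maskNoise (innerPairs s)ᶜ e) i j = noiseMatrix e i j := by
  simp [noiseMatrix, observation, maskNoise, innerPairs, Set.indicator, hi]

lemma measurable_submatrix (F : Fin n → Fin n → ℝ) (s : Finset (Fin n)) :
    Measurable fun e : UpperPair n → ℝ => submatrix (observation F e) s :=
  measurable_pi_lambda _ fun _ => measurable_pi_lambda _ fun _ => measurable_observation _ _ _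

lemma maskNoise_mem_badRefined_iff {s : Finset (Fin n)} (u : s → Circle) (e : UpperPair n → ℝ) :
    maskNoise (innerPairs s)ᶜ e ∈ badRefined n s u ↔ e ∈ badRefined n s u := by
  have key : ∀ i ∉ s, ∀ z z' : Circle,
      ∑ j : s, noiseMatrix (maskNoise (innerPairs s)ᶜ e) i j *
        (geoDist z (u j) - geoDist z' (u j)) =
      ∑ j : s, noiseMatrix e i j * (geoDist z (u j) - geoDist z' (u j)) := fun i hi z z' =>
    Finset.sum_congr rfl fun j _ => by rw [noiseMatrix_maskNoise e hi]
  unfold badRefined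
  simp only [Set.mem_ofPred_eq]
  constructor
  · rintro ⟨i, hi, z, hz, z', hz', h⟩
    exact ⟨i, hi, z, hz, z', hz', by rwa [key i hi] at h⟩
  · rintro ⟨i, hi, z, hz, z', hz', h⟩
    exact ⟨i, hi, z, hz, z', hz', by rwa [key i hi]⟩

/-- Noise values for which the refinement based on the initial estimator on `s` may fail. -/
def badRun (I : InitialEstimator n) (F : Fin n → Fin n → ℝ) (s : Finset (Fin n)) :
    Set (UpperPair n → ℝ) :=
  {e | e ∈ badRefined n s (I.toFun s (submatrix (observation F e) s))}

lemma mem_badRun {I : InitialEstimator n} {F : Fin n → Fin n → ℝ} {s : Finset (Fin n)}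
    {e : UpperPair n → ℝ} : e ∈ badRun I F s ↔
      e ∈ badRefined n s (I.toFun s (submatrix (observation F e) s)) := by
  rw [badRun, Set.mem_ofPred_eq]

/-- Partition by the finitely many values of the initial estimator: on each cell `u` is
deterministic. -/
lemma badRun_eq (I : InitialEstimator n) (F : Fin n → Fin n → ℝ) (s : Finset (Fin n)) :
    badRun I F s = ⋃ u : regularPositions s,
      {e | I.toFun s (submatrix (observation F e) s) = u} ∩ badRefined n s u := by
  ext e
  rw [mem_badRun, Set.mem_iUnion]
  constructor
  · intro h
    obtain ⟨u, hu⟩ : ∃ u : regularPositions s, I.toFun s (submatrix (observation F e) s) = u :=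
      ⟨⟨_, I.regular _ _⟩, rfl⟩
    exact ⟨u, hu, hu ▸ h⟩
  · rintro ⟨u, hu, h⟩
    rw [Set.mem_ofPred_eq] at hu
    rwa [hu]

lemma measurableSet_badRun (I : InitialEstimator n) (F : Fin n → Fin n → ℝ)
    (s : Finset (Fin n)) : MeasurableSet (badRun I F s) := by
  have := (finite_regularPositions s).to_subtype
  rw [badRun_eq]
  exact MeasurableSet.iUnion fun u =>
    (measurable_submatrix F s (I.measurable_level s u)).inter (measurableSet_badRefined s u)

/-- Each cell depends on the noise inside `s`, the failure for its `u` on the remaining noise. The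
probabilities multiply, so no union bound over the values of `u` is paid. -/
lemma measureReal_badRun_le (hE : IsSubGaussianNoise P E) (hn : 4 ≤ n) (I : InitialEstimator n)
    (F : Fin n → Fin n → ℝ) (s : Finset (Fin n)) :
    P.real {ω | (fun p => E p ω) ∈ badRun I F s} ≤ 1 / (n : ℝ) ^ 3 := by
  have := (finite_regularPositions s).to_subtype
  set Z : regularPositions s → Set Ω := fun u =>
    (fun ω => maskNoise (innerPairs s) fun p => E p ω) ⁻¹'
      {e | I.toFun s (submatrix (observation F e) s) = u} with hZ
  set B : regularPositions s → Set Ω := fun u =>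
    (fun ω => maskNoise (innerPairs s)ᶜ fun p => E p ω) ⁻¹' badRefined n s u with hB
  have hZm : ∀ u : regularPositions s,
      MeasurableSet {e | I.toFun s (submatrix (observation F e) s) = u} :=
    fun u => measurable_submatrix F s (I.measurable_level s u)
  have hmask : Measurable fun ω => maskNoise (innerPairs s) fun p => E p ω := by
    refine measurable_pi_lambda _ fun p => ?_
    by_cases hp : p ∈ innerPairs s
    · simpa [maskNoise, hp] using hE.meas p
    · simp [maskNoise, hp]
  have hset : {ω | (fun p => E p ω) ∈ badRun I F s} = ⋃ u, Z u ∩ B u := by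
    ext ω
    rw [Set.mem_ofPred_eq, badRun_eq]
    simp only [hZ, hB, Set.mem_iUnion, Set.mem_inter_iff, Set.mem_preimage, Set.mem_ofPred_eq,
      submatrix_maskNoise, maskNoise_mem_badRefined_iff]
  rw [hset]
  refine measureReal_iUnion_inter_le Z B (fun u => hmask (hZm u)) (fun u v huv => ?_)
    (by positivity) fun u => ?_
  · refine Set.disjoint_left.2 fun ω hu hv => huv (Subtype.ext ?_)
    simp only [hZ, Set.mem_preimage, Set.mem_ofPred_eq] at hu hv
    exact hu.symm.trans hv
  · rw [measureReal_inter_preimage_eq (indepFun_maskNoise hE (innerPairs s)) (hZm u)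
      (measurableSet_badRefined s u)]
    gcongr
    have h := measureReal_badRefined_le hE hn s u
    have h2 : (fun ω => maskNoise (innerPairs s)ᶜ fun p => E p ω) ⁻¹' badRefined n s u =
        {ω | (fun p => E p ω) ∈ badRefined n s u} := by
      ext ω
      simp only [Set.mem_preimage, Set.mem_ofPred_eq, maskNoise_mem_badRefined_iff]
    rw [h2]; exact h

/-- The same decoupling with cells given by the values of `S`: conditioning on an independent split.
-/
lemma measureReal_indep_le {S : Ω → Finset (Fin n)} (hS : Measurable S)
    (hind : IndepFun (fun ω p => E p ω) S P) (B : Finset (Fin n) → Set (UpperPair n → ℝ))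
    (hB : ∀ s, MeasurableSet (B s)) {q : ℝ} (hq : 0 ≤ q)
    (h : ∀ s : Finset (Fin n), P.real {ω | (fun p => E p ω) ∈ B s} ≤ q) :
    P.real {ω | (fun p => E p ω) ∈ B (S ω)} ≤ q := by
  have hset : {ω | (fun p => E p ω) ∈ B (S ω)} =
      ⋃ s, S ⁻¹' {s} ∩ (fun ω p => E p ω) ⁻¹' B s := by
    ext ω; simp
  rw [hset]
  refine measureReal_iUnion_inter_le _ _ (fun s => hS (measurableSet_singleton s))
    (fun s s' hss' => ?_) hq fun s => ?_
  · refine Set.disjoint_left.2 fun ω hu hv => hss' ?_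
    simp only [Set.mem_preimage, Set.mem_singleton_iff] at hu hv
    exact hu.symm.trans hv
  · rw [measureReal_inter_preimage_eq hind.symm (measurableSet_singleton s) (hB s)]
    gcongr
    exact h s

/-- A run of the procedure is good with high probability. -/
lemma measureReal_not_goodRun_le {k : ℕ} (hn : n = 4 * k) (hk : 0 < k) (hr : rate n ≤ 1 / 6)
    (hE : IsSubGaussianNoise P E) {S : Ω → Finset (Fin n)} (hSm : Measurable S)
    (hS : ∀ s : Finset (Fin n), s.card = n / 4 →
      P.real {ω | S ω = s} = 1 / (n.choose (n / 4) : ℝ))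
    (hind : IndepFun (fun ω p => E p ω) S P) (I : InitialEstimator n)
    (F : Fin n → Fin n → ℝ) {y : Fin n → Circle} (hy : y ∈ regularPositions (Fin n)) :
    P.real {ω | (S ω).card = n / 4 ∧ ¬ GoodRun (fun p => E p ω) (S ω)
      (I.toFun (S ω) (submatrix (observation F fun p => E p ω) (S ω))) y} ≤ 3 / (n : ℝ) ^ 3 := by
  have h1 := measureReal_not_spread_le hn hk hr hS hy
  have h2 := measureReal_indep_le hSm hind (fun s => {e | s.card = n / 4 ∧ e ∈ badInit n s})
    (fun s => (MeasurableSet.const _).inter (measurableSet_badInit s))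
    (q := 1 / (n : ℝ) ^ 3) (by positivity) fun s => by
      by_cases hs : s.card = n / 4
      · simpa [hs] using measureReal_badInit_le hE (by omega) hs
      · simp [hs]
  have h3 := measureReal_indep_le hSm hind (fun s => badRun I F s)
    (measurableSet_badRun I F) (q := 1 / (n : ℝ) ^ 3) (by positivity)
    (measureReal_badRun_le hE (by omega) I F)
  refine le_trans (measureReal_mono (fun ω hω => ?_) (measure_ne_top _ _))
    ((measureReal_union_le _ _).trans (add_le_add (measureReal_union_le _ _) le_rfl) |>.trans
      ((add_le_add (add_le_add h1 h2) h3).trans_eq (by ring)))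
  by_contra hno
  rw [Set.mem_union, Set.mem_union, not_or, not_or] at hno
  obtain ⟨⟨ha, hb⟩, hc⟩ := hno
  rw [Set.mem_ofPred_eq, not_and, not_not] at ha
  rw [Set.mem_ofPred_eq, Set.mem_ofPred_eq, not_and] at hb
  rw [Set.mem_ofPred_eq, mem_badRun] at hc
  refine hω.2 ⟨ha hω.1, fun u hu v hv => ?_, fun i hi z hz z' hz' => ?_⟩
  · by_contra! hlt
    exact hb hω.1 ⟨u, hu, v, hv, hlt⟩
  · by_contra! hlt
    refine hc ?_
    rw [badRefined, Set.mem_ofPred_eq]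
    exact ⟨i, hi, z, hz, z', hz', hlt⟩

end Tail

/-! ### Closest representations -/

section Closest

variable {n : ℕ} {cl cL ce : ℝ} {F : Fin n → Fin n → ℝ}

lemma bias_nonneg : 0 ≤ bias cl cL ce F := by
  refine Real.sInf_nonneg ?_
  rintro _ ⟨p, -, rfl⟩
  exact dReg_nonneg _

lemma exists_dReg_lt_bias_add (h : (reps cl cL ce F).Nonempty) {η : ℝ} (hη : 0 < η) :
    ∃ p ∈ reps cl cL ce F, dReg p.1 < bias cl cL ce F + η := by
  have hlt : sInf ((fun p => dReg p.1) '' reps cl cL ce F) < bias cl cL ce F + η :=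
    lt_add_of_pos_right _ hη
  obtain ⟨_, ⟨p, hp, rfl⟩, hlt⟩ := exists_lt_of_csInf_lt (h.image _) hlt
  exact ⟨p, hp, hlt⟩

lemma dReg_le_bias {p : (Fin n → Circle) × (Circle → Circle → ℝ)}
    (hp : p ∈ closestReps cl cL ce F) : dReg p.1 ≤ bias cl cL ce F := by
  refine le_csInf ⟨_, p, hp.1, rfl⟩ ?_
  rintro _ ⟨q, hq, rfl⟩
  exact hp.2 q hq

/-- Some regular positions are approached by representations of almost minimal, or minimal,
distance to regular positions. -/
lemma exists_common_regularPositions (h : (reps cl cL ce F).Nonempty) :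
    ∃ y ∈ regularPositions (Fin n),
      (∀ η : ℝ, 0 < η → ∃ p ∈ reps cl cL ce F, dInf p.1 y ≤ bias cl cL ce F + η) ∧
      ((closestReps cl cL ce F).Nonempty →
        ∃ p ∈ closestReps cl cL ce F, dInf p.1 y ≤ bias cl cL ce F) := by
  by_cases hc : (closestReps cl cL ce F).Nonempty
  · obtain ⟨p, hp⟩ := hc
    obtain ⟨y, hy, hpy⟩ := exists_dInf_eq_dReg p.1
    have hle : dInf p.1 y ≤ bias cl cL ce F := hpy ▸ dReg_le_bias hp
    exact ⟨y, hy, fun η hη => ⟨p, hp.1, by linarith⟩, fun _ => ⟨p, hp, hle⟩⟩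
  · by_contra! hno
    -- Pigeonhole: if every `y` failed at some positive level, the smallest of these finitely many
    -- levels would contradict the definition of the infimum.
    have hno' : ∀ y : regularPositions (Fin n), ∃ η : ℝ, 0 < η ∧ ∀ p ∈ reps cl cL ce F,
        bias cl cL ce F + η < dInf p.1 y := by
      intro y
      by_contra! hy
      exact hc (hno y y.2 hy).1
    choose η hη hlt using hno'
    have := (finite_regularPositions (Fin n)).to_subtype
    have := (regularPositions_nonempty (Fin n)).to_subtype
    obtain ⟨y₀, hy₀⟩ := Finite.exists_min η
    obtain ⟨p, hp, hpη⟩ := exists_dReg_lt_bias_add h (hη y₀)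
    obtain ⟨y, hy, hpy⟩ := exists_dInf_eq_dReg p.1
    have h1 := hlt ⟨y, hy⟩ p hp
    have h2 := hy₀ ⟨y, hy⟩
    simp only at h1
    linarith

lemma continuous_dInf [NeZero n] (y : Fin n → Circle) :
    Continuous fun x : Fin n → Circle => dInf x y := by
  unfold dInf
  simp only [← Finset.sup'_univ_eq_ciSup]
  exact Continuous.finset_sup'_apply _ fun i _ =>
    continuous_geoDist (continuous_apply i) continuous_const

lemma continuous_dReg [NeZero n] : Continuous fun x : Fin n → Circle => dReg x := by
  have hne : (finite_regularPositions (Fin n)).toFinset.Nonempty := by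
    simpa using regularPositions_nonempty (Fin n)
  have h : ∀ x : Fin n → Circle, dReg x =
      (finite_regularPositions (Fin n)).toFinset.inf' hne (dInf x) := by
    intro x
    rw [Finset.inf'_eq_csInf_image, Set.Finite.coe_toFinset]; rfl
  simp only [h]
  exact Continuous.finset_inf'_apply _ fun y _ => continuous_dInf y

lemma slack_zero (n : ℕ) : slack n 0 = 0 := by simp [slack]

/-- For pointwise convergence of `f`, evaluation at the moving points `p.1 i` is not visibly
continuous. The Lipschitz property trades that equation for inequalities at fixed points, each a
closed condition. -/
lemma reps_zero_eq : reps cl cL 0 F =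
    {p | (∀ x y, p.2 x y ∈ Set.Icc (0 : ℝ) 1) ∧ (∀ x y, p.2 x y = p.2 y x) ∧
      (∀ x y y', |p.2 x y - p.2 x y'| ≤ cL * geoDist y y') ∧
      (∀ x y y', geoDist x y' ≤ geoDist x y →
        cl * (geoDist x y - geoDist x y') ≤ p.2 x y' - p.2 x y) ∧
      ∀ i j, i < j → ∀ x y,
        |p.2 x y - F i j| ≤ cL * (geoDist x (p.1 i) + geoDist y (p.1 j))} := by
  ext p
  rw [Set.mem_ofPred_eq]
  constructor
  · rintro ⟨hf, hF⟩
    refine ⟨hf.mem_unit, hf.symm, fun x y y' => ?_, fun x y y' h => ?_, fun i j hij x y => ?_⟩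
    · simpa [slack_zero] using hf.upper x y y'
    · simpa [slack_zero] using hf.lower x y y' h
    · simpa [slack_zero, hF i j hij] using hf.abs_sub_le x (p.1 i) y (p.1 j)
  · rintro ⟨h1, h2, h3, h4, h5⟩
    refine ⟨⟨h1, h2, fun x y y' => ?_, fun x y y' h => ?_⟩, fun i j hij => ?_⟩
    · simpa [slack_zero] using h3 x y y'
    · simpa [slack_zero] using h4 x y y' h
    · have := h5 i j hij (p.1 i) (p.1 j)
      simp only [geoDist_self, add_zero, mul_zero] at this
      exact sub_eq_zero.1 (abs_nonpos_iff.1 this)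

lemma isCompact_reps_zero : IsCompact (reps cl cL 0 F) := by
  have hK : IsCompact ((Set.univ : Set (Fin n → Circle)) ×ˢ
      (Set.univ.pi fun _ => Set.univ.pi fun _ => Set.Icc 0 1 : Set (Circle → Circle → ℝ))) :=
    isCompact_univ.prod (isCompact_univ_pi fun _ => isCompact_univ_pi fun _ => isCompact_Icc)
  refine hK.of_isClosed_subset ?_ fun p hp =>
    ⟨Set.mem_univ _, fun x _ y _ => hp.1.mem_unit x y⟩
  have hev : ∀ x y, Continuous fun p : (Fin n → Circle) × (Circle → Circle → ℝ) => p.2 x y :=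
    fun x y => by fun_prop
  rw [reps_zero_eq]
  simp only [Set.ofPred_and, Set.ofPred_forall]
  refine IsClosed.inter ?_ (IsClosed.inter ?_ (IsClosed.inter ?_ (IsClosed.inter ?_ ?_)))
  · exact isClosed_iInter fun x => isClosed_iInter fun y => isClosed_Icc.preimage (hev x y)
  · exact isClosed_iInter fun x => isClosed_iInter fun y => isClosed_eq (hev x y) (hev y x)
  · exact isClosed_iInter fun x => isClosed_iInter fun y => isClosed_iInter fun y' =>
      isClosed_le ((hev x y).sub (hev x y')).abs continuous_const
  · exact isClosed_iInter fun x => isClosed_iInter fun y => isClosed_iInter fun y' =>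
      isClosed_iInter fun _ => isClosed_le continuous_const ((hev x y').sub (hev x y))
  · refine isClosed_iInter fun i => isClosed_iInter fun j => isClosed_iInter fun _ =>
      isClosed_iInter fun x => isClosed_iInter fun y =>
      isClosed_le ((hev x y).sub continuous_const).abs (continuous_const.mul ?_)
    exact (continuous_geoDist continuous_const (by fun_prop)).add
      (continuous_geoDist continuous_const (by fun_prop))

/-- Without slack, the distance to regular positions is minimized by some representation. -/
lemma closestReps_nonempty [NeZero n] (h : (reps cl cL 0 F).Nonempty) :
    (closestReps cl cL 0 F).Nonempty := by
  obtain ⟨p, hp, hmin⟩ := isCompact_reps_zero.exists_isMinOn h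
    (continuous_dReg.comp continuous_fst).continuousOn
  exact ⟨p, hp, fun q hq => hmin hq⟩

end Closest

/-! ### The random split -/

section Split

variable {Ω : Type*} [MeasurableSpace Ω] {P : Measure Ω} {n : ℕ} {S S' : Ω → Finset (Fin n)}

lemma IsRandomSplit.measureReal_eq (h : IsRandomSplit P S S') {s s' : Finset (Fin n)}
    (hs : s.card = n / 4) (hs' : s'.card = n / 4) (hd : Disjoint s s') :
    P.real {ω | S ω = s ∧ S' ω = s'} =
      1 / (n.choose (n / 4) : ℝ) * (1 / ((n - n / 4).choose (n / 4) : ℝ)) := by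
  rw [h.second s s' hs hs' (Finset.subset_compl_iff_disjoint_left.2 hd), h.first s hs]

lemma IsRandomSplit.measurableSet (h : IsRandomSplit P S S') (s s' : Finset (Fin n)) :
    MeasurableSet {ω | S ω = s ∧ S' ω = s'} :=
  (h.meas (measurableSet_singleton s)).inter (h.meas' (measurableSet_singleton s'))

lemma choose_quarter_pos (n : ℕ) : (0 : ℝ) < (n - n / 4).choose (n / 4) ∧
    (0 : ℝ) < n.choose (n / 4) := by
  constructor <;> exact_mod_cast Nat.choose_pos (by omega)

variable [IsProbabilityMeasure P]

/-- Almost surely, both splits have the prescribed size and they are disjoint. -/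
lemma IsRandomSplit.measureReal_compl_eq_zero (h : IsRandomSplit P S S') :
    P.real {ω | (S ω).card = n / 4 ∧ (S' ω).card = n / 4 ∧ Disjoint (S ω) (S' ω)}ᶜ = 0 := by
  classical
  obtain ⟨hc1, hc2⟩ := choose_quarter_pos n
  set D := (Finset.powersetCard (n / 4) (Finset.univ : Finset (Fin n))).sigma
    fun s => Finset.powersetCard (n / 4) sᶜ with hD
  have hDmem : ∀ q ∈ D, q.1.card = n / 4 ∧ q.2.card = n / 4 ∧ Disjoint q.1 q.2 := by
    intro q hq
    simp only [hD, Finset.mem_sigma, Finset.mem_powersetCard, Finset.subset_univ, true_and] at hq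
    exact ⟨hq.1, hq.2.2, Finset.subset_compl_iff_disjoint_left.1 hq.2.1⟩
  have hset : {ω | (S ω).card = n / 4 ∧ (S' ω).card = n / 4 ∧ Disjoint (S ω) (S' ω)} =
      ⋃ q ∈ D, {ω | S ω = q.1 ∧ S' ω = q.2} := by
    ext ω
    simp only [Set.mem_iUnion, exists_prop, Set.mem_ofPred_eq]
    constructor
    · rintro ⟨h1, h2, h3⟩
      refine ⟨⟨S ω, S' ω⟩, ?_, rfl, rfl⟩
      simp [hD, h1, h2, Finset.subset_compl_iff_disjoint_left, h3]
    · rintro ⟨q, hq, h1, h2⟩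
      rw [h1, h2]
      exact hDmem q hq
  have hmeas : MeasurableSet (⋃ q ∈ D, {ω | S ω = q.1 ∧ S' ω = q.2}) :=
    D.measurableSet_biUnion fun q _ => h.measurableSet q.1 q.2
  -- The admissible pairs are disjoint events whose prescribed probabilities already add up to one.
  rw [hset, probReal_compl_eq_one_sub hmeas, measureReal_biUnion_finset ?_
    fun q _ => h.measurableSet q.1 q.2]
  · rw [Finset.sum_congr rfl fun q hq => h.measureReal_eq (hDmem q hq).1 (hDmem q hq).2.1
      (hDmem q hq).2.2, Finset.sum_const, hD, Finset.card_sigma]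
    have : ∑ s ∈ Finset.powersetCard (n / 4) (Finset.univ : Finset (Fin n)),
        (Finset.powersetCard (n / 4) sᶜ).card =
        n.choose (n / 4) * (n - n / 4).choose (n / 4) := by
      rw [Finset.sum_congr rfl fun s hs => show (Finset.powersetCard (n / 4) sᶜ).card =
        (n - n / 4).choose (n / 4) by
          rw [Finset.card_powersetCard, Finset.card_compl, (Finset.mem_powersetCard.1 hs).2,
            Fintype.card_fin]]
      simp
    rw [this, nsmul_eq_mul]
    push_cast
    field_simp
    simp
  · rintro ⟨s, s'⟩ - ⟨u, u'⟩ - hne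
    refine Set.disjoint_left.2 fun ω h1 h2 => hne ?_
    obtain ⟨rfl, rfl⟩ := h1
    obtain ⟨rfl, rfl⟩ := h2
    rfl

/-- The second split is uniform as well. -/
lemma IsRandomSplit.second_uniform (h : IsRandomSplit P S S') {s' : Finset (Fin n)}
    (hs' : s'.card = n / 4) : P.real {ω | S' ω = s'} = 1 / (n.choose (n / 4) : ℝ) := by
  classical
  obtain ⟨hc1, hc2⟩ := choose_quarter_pos n
  set N := {ω | (S ω).card = n / 4 ∧ (S' ω).card = n / 4 ∧ Disjoint (S ω) (S' ω)}
  have hnull : P Nᶜ = 0 := by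
    have := h.measureReal_compl_eq_zero
    rwa [measureReal_eq_zero_iff] at this
  have hset : {ω | S' ω = s'} ∩ N =
      ⋃ s ∈ Finset.powersetCard (n / 4) s'ᶜ, {ω | S ω = s ∧ S' ω = s'} := by
    ext ω
    simp only [N, Set.mem_iUnion, exists_prop, Set.mem_ofPred_eq, Set.mem_inter_iff,
      Finset.mem_powersetCard, Finset.subset_compl_iff_disjoint_left]
    constructor
    · rintro ⟨h1, h2, -, h4⟩
      exact ⟨S ω, ⟨(h1 ▸ h4).symm, h2⟩, rfl, h1⟩
    · rintro ⟨s, ⟨h1, h2⟩, h3, h4⟩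
      exact ⟨h4, h3 ▸ h2, h4 ▸ hs', h3 ▸ h4 ▸ h1.symm⟩
  have heq : P.real {ω | S' ω = s'} = P.real ({ω | S' ω = s'} ∩ N) := by
    refine measureReal_congr ?_
    have : ∀ᵐ ω ∂P, ω ∈ N := hnull
    filter_upwards [this] with ω hω
    exact propext ⟨fun h => ⟨h, hω⟩, fun h => h.1⟩
  rw [heq, hset, measureReal_biUnion_finset ?_ fun s _ => h.measurableSet s s']
  · rw [Finset.sum_congr rfl fun s hs => h.measureReal_eq (Finset.mem_powersetCard.1 hs).2 hs'
      (Finset.subset_compl_iff_disjoint_left.1 (Finset.mem_powersetCard.1 hs).1).symm,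
      Finset.sum_const, Finset.card_powersetCard, Finset.card_compl, hs', Fintype.card_fin,
      nsmul_eq_mul]
    field_simp
  · intro s _ u _ hne
    exact Set.disjoint_left.2 fun ω h1 h2 => hne (h1.1.symm.trans h2.1)

end Split

/-! ### The high-probability event -/

lemma exists_measurable_event {Ω : Type*} [MeasurableSpace Ω] {P : Measure Ω}
    [IsProbabilityMeasure P] {n k : ℕ} (hn : n = 4 * k) (hk : 0 < k) (hr : rate n ≤ 1 / 6)
    {E : UpperPair n → Ω → ℝ} (hE : IsSubGaussianNoise P E) {S S' : Ω → Finset (Fin n)}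
    (hS : IsRandomSplit P S S') (hind : IndepFun (fun ω p => E p ω) (fun ω => (S ω, S' ω)) P)
    (I I' : InitialEstimator n) (F : Fin n → Fin n → ℝ) {y : Fin n → Circle}
    (hy : y ∈ regularPositions (Fin n)) :
    ∃ G : Set Ω, MeasurableSet G ∧ 1 - 5 / (n : ℝ) ^ 2 ≤ P.real G ∧ ∀ ω ∈ G,
      (S ω).card = n / 4 ∧ (S' ω).card = n / 4 ∧ Disjoint (S ω) (S' ω) ∧
      GoodRun (fun p => E p ω) (S ω)
        (I.toFun (S ω) (submatrix (observation F fun p => E p ω) (S ω))) y ∧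
      GoodRun (fun p => E p ω) (S' ω)
        (I'.toFun (S' ω) (submatrix (observation F fun p => E p ω) (S' ω))) y := by
  have h0 := hS.measureReal_compl_eq_zero
  have h1 := measureReal_not_goodRun_le hn hk hr hE hS.meas hS.first
    (hind.comp measurable_id measurable_fst) I F hy
  have h2 := measureReal_not_goodRun_le hn hk hr hE hS.meas' (fun s hs => hS.second_uniform hs)
    (hind.comp measurable_id measurable_snd) I' F hy
  set B₀ := {ω | (S ω).card = n / 4 ∧ (S' ω).card = n / 4 ∧ Disjoint (S ω) (S' ω)}ᶜ with hB₀
  set B₁ := {ω | (S ω).card = n / 4 ∧ ¬ GoodRun (fun p => E p ω) (S ω)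
      (I.toFun (S ω) (submatrix (observation F fun p => E p ω) (S ω))) y} with hB₁
  set B₂ := {ω | (S' ω).card = n / 4 ∧ ¬ GoodRun (fun p => E p ω) (S' ω)
      (I'.toFun (S' ω) (submatrix (observation F fun p => E p ω) (S' ω))) y} with hB₂
  -- A measurable hull avoids proving measurability of the good runs. The runs share noise, but a
  -- union bound suffices: `6 / n³ ≤ 5 / n²`.
  refine ⟨(toMeasurable P (B₀ ∪ B₁ ∪ B₂))ᶜ, (measurableSet_toMeasurable _ _).compl, ?_,
    fun ω hω => ?_⟩
  · rw [probReal_compl_eq_one_sub (measurableSet_toMeasurable _ _), measureReal_def,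
      measure_toMeasurable, ← measureReal_def]
    have h3 : P.real (B₀ ∪ B₁ ∪ B₂) ≤ 0 + 3 / (n : ℝ) ^ 3 + 3 / (n : ℝ) ^ 3 :=
      (measureReal_union_le _ _).trans (add_le_add ((measureReal_union_le _ _).trans
        (add_le_add h0.le h1)) h2)
    have hn4 : (4 : ℝ) ≤ n := by
      have : 4 ≤ n := by omega
      exact_mod_cast this
    have h4 : 0 + 3 / (n : ℝ) ^ 3 + 3 / (n : ℝ) ^ 3 ≤ 5 / (n : ℝ) ^ 2 := by
      rw [zero_add, ← add_div, div_le_div_iff₀ (by positivity) (by positivity)]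
      have : (0 : ℝ) ≤ n ^ 2 := by positivity
      nlinarith
    linarith
  · have hω' : ω ∉ B₀ ∪ B₁ ∪ B₂ := fun h => hω (subset_toMeasurable _ _ h)
    rw [Set.mem_union, Set.mem_union, not_or, not_or] at hω'
    obtain ⟨⟨h0', h1'⟩, h2'⟩ := hω'
    rw [hB₀, Set.notMem_compl_iff, Set.mem_ofPred_eq] at h0'
    rw [hB₁, Set.mem_ofPred_eq, not_and, not_not] at h1'
    rw [hB₂, Set.mem_ofPred_eq, not_and, not_not] at h2'
    exact ⟨h0'.1, h0'.2.1, h0'.2.2, h1' h0'.1, h2' h0'.2.1⟩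

end LatentCircle

/-! ### The main theorem -/

open LatentCircle
theorem theorem3p1 (cl cL ce : ℝ) (hcl : 0 < cl) (hcL : cl ≤ cL) (hce : 0 ≤ ce) :
    ∃ C : ℝ, 0 < C ∧
      ∀ (n : ℕ), 0 < n → 4 ∣ n →
      ∀ (I I' : InitialEstimator n)
        (Ω : Type*) [MeasurableSpace Ω] (P : Measure Ω) [IsProbabilityMeasure P]
        (xstar : Fin n → Circle) (f : Circle → Circle → ℝ)
        (E : UpperPair n → Ω → ℝ) (S S' : Ω → Finset (Fin n)),
        IsBiLipschitz n cl cL ce f →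
        IsSubGaussianNoise P E →
        IsRandomSplit P S S' →
        IndepFun (fun ω p => E p ω) (fun ω => (S ω, S' ω)) P →
        ∀ F : Fin n → Fin n → ℝ, (∀ i j, F i j = f (xstar i) (xstar j)) →
        ∃ G : Set Ω, MeasurableSet G ∧ 1 - 5 / (n : ℝ) ^ 2 ≤ P.real G ∧
          ∀ ω ∈ G, ∀ xhat : Fin n → Circle,
            IsLocalizeAndRefine I I' (observation F (fun p => E p ω)) (S ω) (S' ω) xhat →
            (∀ η : ℝ, 0 < η → ∃ p ∈ reps cl cL ce F,
              dReg p.1 ≤ bias cl cL ce F + η ∧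
              dInf xhat p.1 ≤ C * (bias cl cL ce F + √(Real.log n / n))) ∧
            (ce = 0 ∨ (closestReps cl cL ce F).Nonempty →
              ∃ p ∈ closestReps cl cL ce F,
                dInf xhat p.1 ≤ C * (bias cl cL ce F + √(Real.log n / n))) := by
  have hK := runConst_pos hcl hcL hce
  set K := runConst cl cL ce with hKdef
  -- `37K + 20 = (5K + 4) + 8(4K + 2)`: the first term covers the main case, the second the trivial
  -- one.
  refine ⟨37 * K + 20, by positivity, ?_⟩
  rintro n hn0 ⟨k, hn⟩ I I' Ω _ P _ xstar f E S S' hf hE hS hind F hF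
  have hne : (reps cl cL ce F).Nonempty := ⟨(xstar, f), hf, fun i j _ => (hF i j).symm⟩
  have : NeZero n := ⟨hn0.ne'⟩
  have hclosest : ce = 0 ∨ (closestReps cl cL ce F).Nonempty →
      (closestReps cl cL ce F).Nonempty := by
    rintro (rfl | h)
    · exact closestReps_nonempty hne
    · exact h
  have hb : 0 ≤ bias cl cL ce F := bias_nonneg
  have hr0 : 0 < rate n := by
    have := one_le_mul_rate (n := n) (by omega)
    refine (rate_nonneg n).lt_of_ne fun h => ?_
    rw [← h] at this; norm_num at this
  change ∃ G : Set Ω, MeasurableSet G ∧ 1 - 5 / (n : ℝ) ^ 2 ≤ P.real G ∧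
          ∀ ω ∈ G, ∀ xhat : Fin n → Circle,
            IsLocalizeAndRefine I I' (observation F (fun p => E p ω)) (S ω) (S' ω) xhat →
            (∀ η : ℝ, 0 < η → ∃ p ∈ reps cl cL ce F,
              dReg p.1 ≤ bias cl cL ce F + η ∧
              dInf xhat p.1 ≤ (37 * K + 20) * (bias cl cL ce F + rate n)) ∧
            (ce = 0 ∨ (closestReps cl cL ce F).Nonempty →
              ∃ p ∈ closestReps cl cL ce F,
                dInf xhat p.1 ≤ (37 * K + 20) * (bias cl cL ce F + rate n))
  set δ := bias cl cL ce F + rate n with hδ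
  -- If `δ` is not small, the claimed bound exceeds `4 ≥ π` and holds for any output. Otherwise `K ≥
  -- 16` forces `rate n ≤ 1 / 6`, hence `n ≥ 36`.
  rcases le_or_gt ((4 * K + 2) * δ) (1 / 2) with hsmall | hlarge
  · have hrδ : rate n ≤ δ := by linarith
    have hK16 : 16 ≤ K := by
      have hcL0 : 0 ≤ cL := hcl.le.trans hcL
      have := initConst_nonneg hcl hcL hce
      have : 0 ≤ 16 / cl * (cL * (16 + (3 * initConst cl cL ce + 97)) + 3 * ce + 16) := by
        positivity
      rw [hKdef]; unfold runConst; linarith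
    have hr6 : rate n ≤ 1 / 6 := by nlinarith
    have hk3 : 3 ≤ k := by
      have h1 := mul_rate_sq hn0
      have h2 := one_le_log (n := n) (by omega)
      have h3 : rate n ^ 2 ≤ (1 / 6) ^ 2 := by gcongr
      have h4 : (0 : ℝ) < n := by exact_mod_cast hn0
      have h5 : (36 : ℝ) ≤ n := by nlinarith
      have h6 : 36 ≤ n := by exact_mod_cast h5
      omega
    obtain ⟨y, hy, happrox, hattained⟩ := exists_common_regularPositions hne
    obtain ⟨G, hGm, hGP, hG⟩ := exists_measurable_event hn (by omega) hr6 hE hS hind I I' F hy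
    refine ⟨G, hGm, hGP, fun ω hω xhat hx => ?_⟩
    obtain ⟨hSc, hSc', hd, hgood, hgood'⟩ := hG ω hω
    have hmain : ∀ p ∈ reps cl cL ce F, dInf p.1 y ≤ δ → ∃ R : ℂ ≃ₗᵢ[ℝ] ℂ,
        dReg (actRep R p).1 ≤ dReg p.1 ∧ dInf xhat (actRep R p).1 ≤ (37 * K + 20) * δ := by
      intro p hp hpy
      obtain ⟨R, hR1, hR2⟩ := localizeAndRefine_bound hn hk3 hcl hcL hce hp hSc hSc' hd I I' hy
        hgood hgood' hpy hrδ hsmall hx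
      refine ⟨R, hR1, hR2.trans ?_⟩
      gcongr <;> linarith
    refine ⟨fun η hη => ?_, fun h => ?_⟩
    -- The cap `rate n` keeps the positions within `δ` of `y` however large `η` is.
    · obtain ⟨p, hp, hpy⟩ := happrox (min η (rate n)) (lt_min hη hr0)
      obtain ⟨R, hR1, hR2⟩ := hmain p hp (hpy.trans (by rw [hδ]; gcongr; exact min_le_right _ _))
      refine ⟨actRep R p, actRep_mem_reps R hp, ?_, hR2⟩
      calc _ ≤ dReg p.1 := hR1
        _ ≤ dInf p.1 y := dReg_le_dInf _ hy
        _ ≤ _ := hpy.trans (by gcongr; exact min_le_left _ _)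
    · obtain ⟨p, hp, hpy⟩ := hattained (hclosest h)
      obtain ⟨R, hR1, hR2⟩ := hmain p hp.1 (by linarith)
      exact ⟨actRep R p, ⟨actRep_mem_reps R hp.1, fun q hq => hR1.trans (hp.2 q hq)⟩, hR2⟩
  · have htriv : ∀ x x' : Fin n → Circle, dInf x x' ≤ (37 * K + 20) * δ := by
      intro x x'
      refine dInf_le (by positivity) fun i => (geoDist_le_pi _ _).trans
        (Real.pi_le_four.trans ?_)
      nlinarith
    refine ⟨Set.univ, MeasurableSet.univ, ?_, fun ω _ xhat _ => ⟨fun η hη => ?_, fun h => ?_⟩⟩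
    · rw [probReal_univ]
      have : (0 : ℝ) ≤ 5 / (n : ℝ) ^ 2 := by positivity
      linarith
    · obtain ⟨p, hp, hlt⟩ := exists_dReg_lt_bias_add hne hη
      exact ⟨p, hp, hlt.le, htriv _ _⟩
    · obtain ⟨p, hp⟩ := hclosest h
      exact ⟨p, hp, htriv _ _⟩
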